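/- **Setting.** Let $K$ be an algebraically closed field of characteristic $0$ with a valuation $v:K\to\mathbb R\cup\{\infty\}$ whose residue field has characteristic $0$. A tropical (Laurent) polynomial with finite support $A\subset\mathbb Z^2$ is a formal expression $f=\bigoplus_{i\in A}p_i\odot w^{i}$ with $p_i\in\mathbb R$, where $\oplus=\min$ and $\odot=+$; its value at $w\in\mathbb R^2$ is $f(w)=\min_{i\in A}(p_i+\langle i,w\rangle)$. Its tropical curve $\mathcal T(f)$ is the set of $w\in\mathbb R^2$ at which this minimum is attained for at least two different $i\in A$; by convention $\mathcal T(\infty)=\mathbb R^2$ for the zero polynomial $\infty$ (empty support). For an integer affine function $L(w)=j_1w_1+j_2w_2+\beta$ ($j_1,j_2,\beta\in\mathbb Z$) and $c\in\mathbb R$, the Euler derivative $\frac{\partial f}{\partial (L+c)}$ is the tropical polynomial obtained from $f$ by keeping exactly the terms with $L(i)+c\neq0$. A Laurent polynomial $F=\sum_{i\in A} a_ix^i\in K[x_1^{\pm1},x_2^{\pm1}]$ (all $a_i\ne 0$) has tropicalization $\mathrm{Trop}(F)=\bigoplus_{i\in A}v(a_i)\odot w^i$. A point $q\in\mathcal T(f)$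 is a *singular point* of $\mathcal T(f)$ if there are $F$ with $\mathrm{Trop}(F)=f$ and $b\in(K^*)^2$ with $v(b)=q$ and $F(b)=F_{x_1}(b)=F_{x_2}(b)=0$. A point $q\in\mathcal T(f)\cap\mathcal T(g)$ is a *non-transversal intersection point* of $f$ and $g$ if there are $F,G$ with $\mathrm{Trop}(F)=f$, $\mathrm{Trop}(G)=g$ and $b\in(K^*)^2$ with $v(b)=q$, $F(b)=G(b)=0$ and vanishing Jacobian $(F_{x_1}G_{x_2}-F_{x_2}G_{x_1})(b)=0$. It is a *torus non-transversal intersection point* if $F,G,b$ can be chosen such that, moreover, $F_{x_k}(b)y_1+G_{x_k}(b)y_2=0$ ($k=1,2$) for some $(y_1,y_2)\in(K^*)^2$. For $f,g,q$, let $\mathcal A(q)$ be the set of all $4$-tuples $(L_1,L_2,c_1,c_2)$ of two integer affine functions and two real numbers such that $q$ lies on at least one of the curves $\mathcal T\big(\frac{\partial f}{\partial L_1}\big)$, $\mathcal T\big(\frac{\partial f}{\partial L_2}\big)$, $\mathcal T\big(\frac{\partial g}{\partial (L_1+c_1)}\big)$, $\mathcal T\big(\frac{\partial g}{\partial (L_2+c_2)}\big)$,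 and let $\mathcal B(q)$ be the set of the $4$-tuples for which $q$ lies on none of them. Consider the conditions 1. for every tuple in $\mathcal A(q)$, $q$ lies on the tropical curve of $\frac{\partial f}{\partial L_1}\odot\frac{\partial g}{\partial (L_2+c_2)}\oplus\frac{\partial f}{\partial L_2}\odot\frac{\partial g}{\partial (L_1+c_1)}$; 2. for every tuple in $\mathcal B(q)$, $\big(\frac{\partial f}{\partial L_1}\odot\frac{\partial g}{\partial (L_2+c_2)}\big)(q)=\big(\frac{\partial f}{\partial L_2}\odot\frac{\partial g}{\partial (L_1+c_1)}\big)(q)$. **Theorem.** Let $A_1,A_2\subset\mathbb Z^2$ be finite and nonempty. There is a finite set $S$ of $4$-tuples such that for all tropical polynomials $f,g$ with supports $A_1,A_2$ and every $q\in\mathcal T(f)\cap\mathcal T(g)$, with the coefficients of $f,g$ and the coordinates of $q$ in the value group $v(K^*)$: (a) $q$ is a non-transversal intersection point of $f$ and $g$ if and only if conditions 1 and 2 hold; moreover, it is enough to check them for the tuples in $S$. (b) If, in addition, $q$ is not a singular point of $\mathcal T(f)$ in case $A_1$ is contained in a line, and $q$ is not a singular point of $\mathcal T(g)$ in case $A_2$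 is contained in a line (so always if neither support is contained in a line), then $q$ is a torus non-transversal intersection point of $f$ and $g$ if and only if conditions 1 and 2 hold; again it is enough to check them for the tuples in $S$. -/

import Mathlib

open Tropical

noncomputable section

/-- Laurent polynomials in `d` variables over the semiring `R`: finite formal sums of monomials
with exponents in `ℤ^d`. -/
abbrev Laurent (d : ℕ) (R : Type*) [Semiring R] : Type _ :=
  AddMonoidAlgebra R (Fin d → ℤ)

/-- The tropical (min-plus) semifield `ℝ ∪ {∞}`: its sum is `min`, its product is `+`,
its zero is `∞`. -/
abbrev Trop : Type := Tropical (WithTop ℝ)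

/-- Tropical Laurent polynomials in `d` variables. The support of `f` is `f.coeff.support`,
the set of exponents with real (that is, not infinite) coefficient. -/
abbrev TropPoly (d : ℕ) : Type := Laurent d Trop

namespace TropPoly

variable {d : ℕ}

/-- The value at `w` of the term of exponent `i` of `f`, that is `p_i + ⟨i, w⟩`. -/
def term (f : TropPoly d) (i : Fin d → ℤ) (w : Fin d → ℝ) : Trop :=
  f.coeff i * trop ((∑ j, (i j : ℝ) * w j : ℝ) : WithTop ℝ)

/-- The value `f(w)`, that is the minimum over the support of the values of the terms
(the finite sum is the one of the tropical semifield). -/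
def eval (f : TropPoly d) (w : Fin d → ℝ) : Trop :=
  ∑ i ∈ f.coeff.support, f.term i w

/-- The tropical hypersurface of `f`: the points where the minimum is attained at two distinct
exponents of the support. The zero polynomial (all coefficients `∞`) vanishes everywhere. -/
def hypersurface (f : TropPoly d) : Set (Fin d → ℝ) :=
  {w | f = 0 ∨ ∃ i₁ ∈ f.coeff.support, ∃ i₂ ∈ f.coeff.support, i₁ ≠ i₂ ∧
    f.eval w = f.term i₁ w ∧ f.eval w = f.term i₂ w}

end TropPoly

/-- An integer affine function `L(w) = j_1 w_1 + ... + j_d w_d + β` with `j ∈ ℤ^d`, `β ∈ ℤ`. -/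
@[ext]
structure IntAffine (d : ℕ) where
  /-- the coefficients `j` -/
  lin : Fin d → ℤ
  /-- the constant term `β` -/
  const : ℤ

/-- The value of an integer affine function at a lattice point. -/
def IntAffine.eval {d : ℕ} (L : IntAffine d) (i : Fin d → ℤ) : ℤ :=
  (∑ j, L.lin j * i j) + L.const

/-- The Euler derivative `∂f/∂(L + c)` for an integer affine function `L` and a real constant `c`:
only the terms of `f` with exponents `i` such that `L(i) + c ≠ 0` are kept.
In particular `tropDeriv f L 0` is `∂f/∂L`. -/
def tropDeriv {d : ℕ} (f : TropPoly d) (L : IntAffine d) (c : ℝ) : TropPoly d :=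
  open Classical in
  AddMonoidAlgebra.ofCoeff (f.coeff.filter fun i => (L.eval i : ℝ) + c ≠ 0)

namespace Laurent

variable {d : ℕ} {K : Type*} [Field K]

/-- The value of a Laurent polynomial at a point of the torus. -/
def eval (F : Laurent d K) (b : Fin d → Kˣ) : K :=
  F.coeff.sum fun i a => a * ∏ j, ((b j ^ i j : Kˣ) : K)

/-- The formal partial derivative `∂F/∂x_k`. -/
def pderiv (k : Fin d) (F : Laurent d K) : Laurent d K :=
  F.coeff.sum fun i a => AddMonoidAlgebra.single (i - Pi.single k 1) ((i k : K) * a)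

/-- The tropicalization of a Laurent polynomial: take the valuation of every coefficient. -/
def tropicalization (v : AddValuation K (WithTop ℝ)) (F : Laurent d K) : TropPoly d :=
  AddMonoidAlgebra.ofCoeff (F.coeff.mapRange (fun a => trop (v a)) (by simp))

end Laurent

section Points

variable {K : Type*} [Field K] (v : AddValuation K (WithTop ℝ))

/-- `q` is a singular point of the tropical hypersurface of `f`: some Laurent polynomial `F` with
tropicalization `f` has a singular zero in the torus with coordinatewise valuation `q`. -/
def IsSingularPoint {d : ℕ} (f : TropPoly d) (q : Fin d → ℝ) : Prop :=
  ∃ (F : Laurent d K) (b : Fin d → Kˣ),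
    F.tropicalization v = f ∧ (∀ j, v (b j : K) = (q j : WithTop ℝ)) ∧
    F.eval b = 0 ∧ ∀ k, (F.pderiv k).eval b = 0

/-- `q` is a non-transversal intersection point of the curves of `f` and `g`: there are lifts
`F`, `G` and `b` of `f`, `g` and `q` such that `b` is a common zero of `F` and `G` at which their
Jacobian vanishes. -/
def IsNonTransversal (f g : TropPoly 2) (q : Fin 2 → ℝ) : Prop :=
  ∃ (F G : Laurent 2 K) (b : Fin 2 → Kˣ),
    F.tropicalization v = f ∧ G.tropicalization v = g ∧
    (∀ j, v (b j : K) = (q j : WithTop ℝ)) ∧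
    F.eval b = 0 ∧ G.eval b = 0 ∧
    Matrix.det !![(F.pderiv 0).eval b, (G.pderiv 0).eval b;
                  (F.pderiv 1).eval b, (G.pderiv 1).eval b] = 0

/-- The same with the non-extremal form of non-transversality: the Jacobian matrix is required to
have a kernel vector `(y₁, y₂)` in the torus, that is with both coordinates nonzero. -/
def IsTorusNonTransversal (f g : TropPoly 2) (q : Fin 2 → ℝ) : Prop :=
  ∃ (F G : Laurent 2 K) (b : Fin 2 → Kˣ),
    F.tropicalization v = f ∧ G.tropicalization v = g ∧
    (∀ j, v (b j : K) = (q j : WithTop ℝ)) ∧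
    F.eval b = 0 ∧ G.eval b = 0 ∧
    ∃ y₁ y₂ : Kˣ, ∀ k, (F.pderiv k).eval b * y₁ + (G.pderiv k).eval b * y₂ = 0

end Points

/-- A `4`-tuple `(L₁, L₂, c₁, c₂)` of two integer affine functions in two variables and
two real numbers. -/
@[ext]
structure FourTuple where
  L₁ : IntAffine 2
  L₂ : IntAffine 2
  c₁ : ℝ
  c₂ : ℝ

namespace FourTuple

/-- `∂f/∂L₁ ⊙ ∂g/∂(L₂ + c₂)` -/
def prod₁ (τ : FourTuple) (f g : TropPoly 2) : TropPoly 2 :=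
  tropDeriv f τ.L₁ 0 * tropDeriv g τ.L₂ τ.c₂

/-- `∂f/∂L₂ ⊙ ∂g/∂(L₁ + c₁)` -/
def prod₂ (τ : FourTuple) (f g : TropPoly 2) : TropPoly 2 :=
  tropDeriv f τ.L₂ 0 * tropDeriv g τ.L₁ τ.c₁

/-- `𝓐(q)`: the tuples such that `q` lies on at least one of the four derivative curves. -/
def setA (f g : TropPoly 2) (q : Fin 2 → ℝ) : Set FourTuple :=
  {τ | q ∈ (tropDeriv f τ.L₁ 0).hypersurface ∨ q ∈ (tropDeriv f τ.L₂ 0).hypersurface ∨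
    q ∈ (tropDeriv g τ.L₁ τ.c₁).hypersurface ∨ q ∈ (tropDeriv g τ.L₂ τ.c₂).hypersurface}

/-- `𝓑(q)`: the tuples such that `q` lies on none of the four derivative curves. -/
def setB (f g : TropPoly 2) (q : Fin 2 → ℝ) : Set FourTuple :=
  {τ | q ∉ (tropDeriv f τ.L₁ 0).hypersurface ∧ q ∉ (tropDeriv f τ.L₂ 0).hypersurface ∧
    q ∉ (tropDeriv g τ.L₁ τ.c₁).hypersurface ∧ q ∉ (tropDeriv g τ.L₂ τ.c₂).hypersurface}

/-- The two conditions, checked on the tuples that belong to `S`. -/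
def Conditions (S : Set FourTuple) (f g : TropPoly 2) (q : Fin 2 → ℝ) : Prop :=
  (∀ τ ∈ S ∩ setA f g q, q ∈ (τ.prod₁ f g + τ.prod₂ f g).hypersurface) ∧
  (∀ τ ∈ S ∩ setB f g q, (τ.prod₁ f g).eval q = (τ.prod₂ f g).eval q)

end FourTuple

/-- The lattice points of `A` lie on a line of `ℝ²`. -/
def OnLine (A : Finset (Fin 2 → ℤ)) : Prop :=
  Collinear ℝ ((fun (i : Fin 2 → ℤ) (j : Fin 2) => (i j : ℝ)) '' (A : Set (Fin 2 → ℤ)))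

end

open Tropical

noncomputable section

/-! The idea is to replace coefficients by term values. For fixed `b`, the values `x i = a_i b^i` of
the terms of `F` determine `F`, and their valuations are the values at `q` of the terms of `f`. In
the unknowns `x i * y` and `z j`, with `y = y₁ / y₂`, torus non-transversality becomes a homogeneous
linear system with integer coefficients. Its integral consequences are the forms `∑ L(i) x_i y + ∑
(L(j) + c) z_j`, whose supports are those of `∂f/∂L` and `∂g/∂(L + c)`.

Since the residue field has characteristic 0, nonzero rational numbers have valuation 0. Hence
prescribed valuations are realised by a solution exactly when no integral consequence has a unique
minimal term (`AddValuation.not_hasUniqueMin_of_sum_eq_zero`, `AddValuation.exists_lift`). With `t`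
the tropical value of `y`, this says that all pairs of derivatives balance. A unique minimum of
`∂f/∂L` bounds `t` from below, and one of `∂g/∂(L + c)` bounds it from above.

Such bounds on one unknown have a common solution as soon as each lower bound is at most each upper
bound (`exists_common_multiplier`). Cross-multiplied, this compatibility is `ProductBound`; over all
tuples it is equivalent to conditions 1 and 2. A bound degenerates only if a derivative is `∞`,
which for a nonconstant `L` forces the support onto a line; there non-singularity restores
finiteness. Without that assumption, a singular point of one curve gives non-transversality
directly. Finally, a tuple matters only through the zero sets of its four affine functions on the
supports, of which there are finitely many. -/

/-- The function `u` has a unique minimum on the set described by `p`. -/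
def HasUniqueMin {ι Γ : Type*} [LT Γ] (p : ι → Prop) (u : ι → Γ) : Prop :=
  ∃ i, p i ∧ ∀ k, p k → k ≠ i → u i < u k

/-! ### Valuations in residue characteristic zero -/

namespace AddValuation

variable {K : Type*} [Field K] (v : AddValuation K (WithTop ℝ))

theorem natCast_nonneg (n : ℕ) : 0 ≤ v (n : K) := by
  induction n with
  | zero => simp
  | succ n ih =>
    rw [Nat.cast_succ]
    exact v.map_le_add ih (by simp)

/-- A nonzero integer stays nonzero in the residue field, so it is a unit of the valuation ring. -/
theorem map_natCast_eq_zero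
    (hres : CharZero (IsLocalRing.ResidueField (AddValuation.toValuation v).valuationSubring))
    {n : ℕ} (hn : n ≠ 0) : v (n : K) = 0 := by
  have h1 : IsLocalRing.residue (AddValuation.toValuation v).valuationSubring (n : _) ≠ 0 := by
    rw [map_natCast]
    exact_mod_cast hn
  rw [IsLocalRing.residue_ne_zero_iff_isUnit] at h1
  obtain ⟨y, hy⟩ := h1.exists_right_inv
  have hy2 : (n : K) * (y : K) = 1 := by
    have := congrArg (fun z : (AddValuation.toValuation v).valuationSubring => (z : K)) hy
    simpa using this
  have hy3 : 0 ≤ v (y : K) := y.2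
  have hy4 := congrArg v hy2
  rw [v.map_mul, v.map_one] at hy4
  exact le_antisymm (hy4 ▸ le_add_of_nonneg_right hy3) (v.natCast_nonneg n)

theorem map_intCast_eq_zero
    (hres : CharZero (IsLocalRing.ResidueField (AddValuation.toValuation v).valuationSubring))
    {n : ℤ} (hn : n ≠ 0) : v (n : K) = 0 := by
  have h := v.map_natCast_eq_zero hres (Int.natAbs_ne_zero.2 hn)
  rcases Int.natAbs_eq n with h1 | h1
  · rw [h1, Int.cast_natCast, h]
  · rw [h1, Int.cast_neg, Int.cast_natCast, v.map_neg, h]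

theorem map_ratCast_eq_zero [CharZero K]
    (hres : CharZero (IsLocalRing.ResidueField (AddValuation.toValuation v).valuationSubring))
    {r : ℚ} (hr : r ≠ 0) : v (r : K) = 0 := by
  have h1 : (r : K) * (r.den : K) = (r.num : K) := by
    exact_mod_cast congrArg (fun x : ℚ => (x : K)) (Rat.mul_den_eq_num r)
  have h2 := congrArg v h1
  rwa [v.map_mul, v.map_natCast_eq_zero hres r.den_nz,
    v.map_intCast_eq_zero hres (Rat.num_ne_zero.2 hr), add_zero] at h2

theorem map_sum_eq_of_lt {ι : Type*} [DecidableEq ι] {s : Finset ι} {a : ι → K} {i : ι}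
    (hi : i ∈ s) (h0 : v (a i) ≠ ⊤) (h : ∀ k ∈ s, k ≠ i → v (a i) < v (a k)) :
    v (∑ k ∈ s, a k) = v (a i) := by
  rw [← Finset.add_sum_erase s a hi]
  refine v.map_add_eq_of_lt_left (v.map_lt_sum h0 fun k hk => ?_)
  exact h k (Finset.mem_of_mem_erase hk) (Finset.ne_of_mem_erase hk)

/-- The terms of a vanishing integral linear combination do not have a unique minimal valuation. -/
theorem not_hasUniqueMin_of_sum_eq_zero {ι : Type*} [Fintype ι]
    (hres : CharZero (IsLocalRing.ResidueField (AddValuation.toValuation v).valuationSubring))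
    {n : ι → ℤ} {x : ι → K} (hx : ∀ i, x i ≠ 0) (h : ∑ i, (n i : K) * x i = 0) :
    ¬ HasUniqueMin (fun i => n i ≠ 0) (fun i => v (x i)) := by
  classical
  rintro ⟨i, hi, hmin⟩
  have hv : ∀ k, n k ≠ 0 → v ((n k : K) * x k) = v (x k) := fun k hk => by
    rw [v.map_mul, v.map_intCast_eq_zero hres hk, zero_add]
  have htop : ∀ k, v (x k) ≠ ⊤ := fun k => (v.ne_top_iff).2 (hx k)
  have := v.map_sum_eq_of_lt (a := fun k => (n k : K) * x k) (Finset.mem_univ i)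
    (by rw [hv i hi]; exact htop i) (fun k _ hk => by
      rw [hv i hi]
      by_cases hk0 : n k = 0
      · rw [hk0, Int.cast_zero, zero_mul, v.map_zero]
        exact (htop i).lt_top
      · rw [hv k hk0]
        exact hmin k hk0 hk)
  rw [h, hv i hi, v.map_zero] at this
  exact htop i this.symm

end AddValuation

/-! ### Lifting prescribed valuations to a rational linear space -/

section Lifting

variable {ι m Γ : Type*} [Fintype ι] [Fintype m] [LinearOrder Γ]

theorem exists_int_multiple (n : m → ℚ) : ∃ (N : ℤ) (z : m → ℤ), N ≠ 0 ∧ ∀ r, (z r : ℚ) = N * n r := by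
  classical
  refine ⟨∏ r, ((n r).den : ℤ), fun r => (∏ s ∈ Finset.univ.erase r, ((n s).den : ℤ)) * (n r).num,
    Finset.prod_ne_zero_iff.2 fun r _ => by exact_mod_cast (n r).den_nz, fun r => ?_⟩
  rw [← Finset.mul_prod_erase _ _ (Finset.mem_univ r)]
  push_cast
  rw [mul_comm ((n r).den : ℚ), mul_assoc, mul_comm ((n r).den : ℚ), Rat.mul_den_eq_num]

/-- The rational solutions of the system with rows `R` that vanish at the indices `k` with
`γ < u k`. -/
def solutionsBelow (R : m → ι → ℤ) (u : ι → Γ) (γ : Γ) : Submodule ℚ (ι → ℚ) where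
  carrier := {x | (∀ r, ∑ i, (R r i : ℚ) * x i = 0) ∧ ∀ k, γ < u k → x k = 0}
  zero_mem' := by simp
  add_mem' := fun {a b} ha hb => ⟨fun r => by simp [mul_add, Finset.sum_add_distrib, ha.1, hb.1],
    fun k hk => by simp [ha.2 k hk, hb.2 k hk]⟩
  smul_mem' := fun c a ha => ⟨fun r => by
    simp [mul_left_comm _ c, ← Finset.mul_sum, ha.1], fun k hk => by simp [ha.2 k hk]⟩

/-- By duality: if every such solution vanished at `i`, the coordinate form at `i` would be a
combination of rows and of coordinate forms with larger `u`. Clearing denominators would give an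
integral form with unique minimum at `i`. -/
theorem exists_mem_solutionsBelow_ne_zero {R : m → ι → ℤ} {u : ι → Γ}
    (h : ∀ n : m → ℤ, ¬ HasUniqueMin (fun i => ∑ r, n r * R r i ≠ 0) u) (i : ι) :
    ∃ x ∈ solutionsBelow R u (u i), x i ≠ 0 := by
  classical
  let W : Submodule ℚ (ι → ℚ) := Submodule.span ℚ (Set.range fun r k => (R r k : ℚ))
  let Z : Submodule ℚ (ι → ℚ) :=
    { carrier := {z | ∀ k, u k ≤ u i → z k = 0}
      zero_mem' := by simp
      add_mem' := fun {a b} ha hb k hk => by simp [ha k hk, hb k hk]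
      smul_mem' := fun c a ha k hk => by simp [ha k hk] }
  have hmem : (Pi.single i 1 : ι → ℚ) ∉ W ⊔ Z := by
    intro hc
    obtain ⟨w, hw, z, hz, hwz⟩ := Submodule.mem_sup.1 hc
    obtain ⟨c, hc⟩ := (Submodule.mem_span_range_iff_exists_fun ℚ).1 hw
    obtain ⟨N, n, hN, hn⟩ := exists_int_multiple c
    have key : ∀ k, ((∑ r, n r * R r k : ℤ) : ℚ) = N * w k := fun k => by
      push_cast
      rw [← hc, Finset.sum_apply, Finset.mul_sum]
      exact Finset.sum_congr rfl fun r _ => by simp [hn, mul_assoc]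
    have hwk : ∀ k, u k ≤ u i → w k = (Pi.single i 1 : ι → ℚ) k := fun k hk => by
      rw [← hwz, Pi.add_apply, hz k hk, add_zero]
    refine h n ⟨i, ?_, fun k hk hki => ?_⟩
    · have : ((∑ r, n r * R r i : ℤ) : ℚ) ≠ 0 := by
        rw [key, hwk i le_rfl]
        simpa using hN
      exact_mod_cast this
    · by_contra hle
      apply hk
      have : ((∑ r, n r * R r k : ℤ) : ℚ) = 0 := by
        rw [key, hwk k (not_lt.1 hle), Pi.single_eq_of_ne hki, mul_zero]
      exact_mod_cast this
  obtain ⟨φ, hφ, hker⟩ := Submodule.exists_le_ker_of_notMem hmem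
  refine ⟨fun k => φ (Pi.single k 1), ⟨fun r => ?_, fun k hk => ?_⟩, hφ⟩
  · have h1 : φ (fun k => (R r k : ℚ)) = 0 :=
      hker (Submodule.mem_sup_left (Submodule.subset_span ⟨r, rfl⟩))
    rw [LinearMap.pi_apply_eq_sum_univ] at h1
    have h2 : ∀ k : ι, (fun j => if k = j then (1 : ℚ) else 0) = Pi.single k 1 := fun k => by
      ext j
      simp [Pi.single_apply, eq_comm]
    simpa only [h2, smul_eq_mul] using h1
  · refine hker (Submodule.mem_sup_right fun l hl => Pi.single_eq_of_ne ?_ 1)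
    rintro rfl
    exact absurd hk (not_lt.2 hl)

/-- Lifting to a rational linear space: if on the support of every integral linear form vanishing
on the space the minimum of the prescribed valuations is not unique, then the space has a point
with these valuations. -/
theorem AddValuation.exists_lift {K : Type*} [Field K] [CharZero K]
    (v : AddValuation K (WithTop ℝ))
    (hres : CharZero (IsLocalRing.ResidueField (AddValuation.toValuation v).valuationSubring))
    {R : m → ι → ℤ} {T : ι → K} (hT : ∀ i, T i ≠ 0)
    (h : ∀ n : m → ℤ, ¬ HasUniqueMin (fun i => ∑ r, n r * R r i ≠ 0) (fun i => v (T i))) :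
    ∃ x : ι → K, (∀ i, v (x i) = v (T i)) ∧ ∀ r, ∑ i, (R r i : K) * x i = 0 := by
  classical
  set u : ι → WithTop ℝ := fun i => v (T i) with hu
  -- One scalar per level, shared by all indices of that level, so that scaling a rational solution
  -- preserves the equations.
  have hs : ∀ γ : WithTop ℝ, ∃ s : K, γ ∈ Set.range u → v s = γ := fun γ => by
    by_cases hγ : γ ∈ Set.range u
    · obtain ⟨i, hi⟩ := hγ
      exact ⟨T i, fun _ => hi⟩
    · exact ⟨0, fun h => absurd h hγ⟩
  choose s hs using hs
  have hx : ∀ γ : WithTop ℝ, ∃ x ∈ solutionsBelow R u γ, ∀ i : {i // u i = γ}, x i ≠ 0 := by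
    intro γ
    -- As `ℚ` is infinite, a vector space over it is not covered by finitely many proper subspaces.
    exact Module.Dual.exists_forall_mem_ne_zero_of_forall_exists (K := ℚ) (solutionsBelow R u γ)
      (fun i : {i // u i = γ} => LinearMap.proj (i : ι))
      (fun i => by
        obtain ⟨x, hx, hxi⟩ := exists_mem_solutionsBelow_ne_zero h i
        rw [i.2] at hx
        exact ⟨x, hx, hxi⟩)
  choose x hx hx0 using hx
  -- At `i`, the solution of level `γ` contributes only if `u i ≤ γ`, and it does contribute for `γ
  -- = u i`; so the valuation of the sum is `u i`.
  refine ⟨fun i => ∑ γ ∈ Finset.univ.image u, s γ * (x γ i : K), fun i => ?_, fun r => ?_⟩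
  · have hsv : ∀ k, v (s (u k)) = u k := fun k => hs _ ⟨k, rfl⟩
    have hself : v (s (u i) * (x (u i) i : K)) = u i := by
      rw [v.map_mul, hsv, v.map_ratCast_eq_zero hres (hx0 (u i) ⟨i, rfl⟩), add_zero]
    have htop : u i ≠ ⊤ := (v.ne_top_iff).2 (hT i)
    rw [v.map_sum_eq_of_lt (i := u i) (Finset.mem_image_of_mem u (Finset.mem_univ i))
      (by rw [hself]; exact htop) ?_, hself]
    intro γ hγ hne
    obtain ⟨k, -, rfl⟩ := Finset.mem_image.1 hγ
    rw [hself]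
    by_cases h0 : x (u k) i = 0
    · rw [h0, Rat.cast_zero, mul_zero, v.map_zero]
      exact htop.lt_top
    · rw [v.map_mul, hsv, v.map_ratCast_eq_zero hres h0, add_zero]
      exact lt_of_le_of_ne (not_lt.1 fun hlt => h0 ((hx (u k)).2 i hlt)) hne.symm
  · have hsum : ∀ γ, ∑ i, (R r i : K) * (x γ i : K) = 0 := fun γ => by
      exact_mod_cast congrArg (fun z : ℚ => (z : K)) ((hx γ).1 r)
    simp_rw [Finset.mul_sum]
    rw [Finset.sum_comm]
    refine Finset.sum_eq_zero fun γ _ => ?_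
    simp_rw [mul_left_comm _ (s γ)]
    rw [← Finset.mul_sum, hsum, mul_zero]

end Lifting

/-! ### Order and arithmetic of the tropical semifield -/

namespace Tropical

variable {ι R : Type*} [LinearOrder R] [OrderTop R] {s : Finset ι} {a : ι → Tropical R}
  {x : Tropical R}

theorem le_sum (h : ∀ i ∈ s, x ≤ a i) : x ≤ ∑ i ∈ s, a i := by
  rw [← untrop_le_iff, Finset.untrop_sum']
  exact Finset.le_inf fun i hi => h i hi

theorem sum_le {i : ι} (hi : i ∈ s) : ∑ i ∈ s, a i ≤ a i := by
  rw [← untrop_le_iff, Finset.untrop_sum']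
  exact Finset.inf_le (f := untrop ∘ a) hi

/-- The bound `x < 0` is needed for the empty sum, which is the top element. -/
theorem lt_sum (hx : x < 0) (h : ∀ i ∈ s, x < a i) : x < ∑ i ∈ s, a i := by
  rw [← untrop_lt_iff, Finset.untrop_sum']
  exact (Finset.lt_inf_iff (untrop_lt_iff.2 hx)).2 fun i hi => h i hi

theorem add_eq_min {R : Type*} [LinearOrder R] (y z : Tropical R) : y + z = min y z := rfl

theorem lt_add {R : Type*} [LinearOrder R] {x y z : Tropical R} (h₁ : x < y) (h₂ : x < z) : x < y + z := by
  rw [add_eq_min]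
  exact lt_min h₁ h₂

theorem add_le_left {R : Type*} [LinearOrder R] (y z : Tropical R) : y + z ≤ y := by
  rw [add_eq_min]
  exact min_le_left y z

end Tropical

namespace Trop

theorem lt_zero_iff {x : Trop} : x < 0 ↔ x ≠ 0 :=
  ⟨ne_of_lt, fun h => lt_of_le_of_ne (le_zero x) h⟩

theorem mul_lt_mul_left {x y z : Trop} (hx : x ≠ 0) (h : y < z) : x * y < x * z :=
  (WithTop.add_lt_add_iff_left (x := untrop x) fun h => hx (untrop_injective h)).2 h

theorem mul_lt_mul_right {x y z : Trop} (hx : x ≠ 0) (h : y < z) : y * x < z * x :=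
  (WithTop.add_lt_add_iff_right (z := untrop x) fun h => hx (untrop_injective h)).2 h

theorem mul_lt_mul {x y x' y' : Trop} (h₁ : x < x') (h₂ : y < y') : x * y < x' * y' :=
  WithTop.add_lt_add (α := ℝ) h₁ h₂

end Trop

/-! ### Values and hypersurfaces of tropical polynomials -/

namespace TropPoly

variable {d : ℕ} (f g : TropPoly d) (w : Fin d → ℝ)

theorem term_eq_zero_iff {i : Fin d → ℤ} : f.term i w = 0 ↔ i ∉ f.coeff.support := by
  rw [term, mul_eq_zero, Finsupp.notMem_support_iff, or_iff_left (trop_coe_ne_zero _)]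

variable {f g w}

theorem term_ne_zero {i : Fin d → ℤ} (hi : i ∈ f.coeff.support) : f.term i w ≠ 0 :=
  fun h => (f.term_eq_zero_iff w).1 h hi

theorem eval_le_term (i : Fin d → ℤ) : f.eval w ≤ f.term i w := by
  by_cases hi : i ∈ f.coeff.support
  · exact sum_le hi
  · rw [(f.term_eq_zero_iff w).2 hi]
    exact le_zero _

theorem le_eval {x : Trop} (h : ∀ i ∈ f.coeff.support, x ≤ f.term i w) : x ≤ f.eval w :=
  le_sum h

theorem eval_zero : (0 : TropPoly d).eval w = 0 := rfl

theorem exists_eval_eq_term (hf : f ≠ 0) : ∃ i ∈ f.coeff.support, f.eval w = f.term i w := by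
  have hne : f.coeff.support.Nonempty :=
    Finsupp.support_nonempty_iff.2 fun h => hf (AddMonoidAlgebra.coeff_eq_zero.1 h)
  obtain ⟨i, hi, hmin⟩ := f.coeff.support.exists_min_image (fun i => f.term i w) hne
  exact ⟨i, hi, le_antisymm (eval_le_term i) (le_eval hmin)⟩

theorem eval_eq_zero_iff : f.eval w = 0 ↔ f = 0 := by
  refine ⟨fun h => ?_, fun h => by rw [h, eval_zero]⟩
  by_contra hf
  obtain ⟨i, hi, he⟩ := exists_eval_eq_term (w := w) hf
  exact term_ne_zero hi (he.symm.trans h)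

theorem term_add (i : Fin d → ℤ) : (f + g).term i w = f.term i w + g.term i w := by
  simp only [term, AddMonoidAlgebra.coeff_add, Finsupp.add_apply, add_mul]

theorem term_mul (k : Fin d → ℤ) : (f * g).term k w =
    ∑ i ∈ f.coeff.support, ∑ j ∈ g.coeff.support,
      if i + j = k then f.term i w * g.term j w else 0 := by
  classical
  rw [term, AddMonoidAlgebra.coeff_mul, Finsupp.sum, Finset.sum_mul]
  refine Finset.sum_congr rfl fun i _ => ?_
  rw [Finsupp.sum, Finset.sum_mul]
  refine Finset.sum_congr rfl fun j _ => ?_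
  split_ifs with h
  · have : trop ((∑ l, (k l : ℝ) * w l : ℝ) : WithTop ℝ)
        = trop ((∑ l, (i l : ℝ) * w l : ℝ) : WithTop ℝ)
          * trop ((∑ l, (j l : ℝ) * w l : ℝ) : WithTop ℝ) := by
      rw [← trop_add, ← WithTop.coe_add, ← Finset.sum_add_distrib, ← h]
      simp only [Pi.add_apply, Int.cast_add, add_mul]
    rw [this, term, term, mul_mul_mul_comm]
  · rw [zero_mul]

theorem term_mul_le {i j : Fin d → ℤ} (hi : i ∈ f.coeff.support) (hj : j ∈ g.coeff.support) :
    (f * g).term (i + j) w ≤ f.term i w * g.term j w := by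
  rw [term_mul]
  refine le_trans (sum_le hi) (le_trans (sum_le hj) ?_)
  rw [if_pos rfl]

theorem eval_mul_eval_le_term (k : Fin d → ℤ) : f.eval w * g.eval w ≤ (f * g).term k w := by
  rw [term_mul]
  refine le_sum fun i _ => le_sum fun j _ => ?_
  split_ifs
  · exact mul_le_mul' (eval_le_term i) (eval_le_term j)
  · exact le_zero _

theorem eval_mul : (f * g).eval w = f.eval w * g.eval w := by
  refine le_antisymm ?_ (le_eval fun k _ => eval_mul_eval_le_term k)
  by_cases hf : f = 0
  · rw [hf, zero_mul, eval_zero, zero_mul]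
  by_cases hg : g = 0
  · rw [hg, mul_zero, eval_zero, mul_zero]
  obtain ⟨i, hi, hfi⟩ := exists_eval_eq_term (w := w) hf
  obtain ⟨j, hj, hgj⟩ := exists_eval_eq_term (w := w) hg
  rw [hfi, hgj]
  exact (eval_le_term _).trans (term_mul_le hi hj)

theorem mem_hypersurface_of_lt {i j : Fin d → ℤ} (hij : i ≠ j) (h0 : f.eval w ≠ 0)
    (hi : f.term i w ≤ f.eval w) (hj : f.term j w ≤ f.eval w) : w ∈ f.hypersurface := by
  have aux : ∀ k, f.term k w ≤ f.eval w → k ∈ f.coeff.support ∧ f.eval w = f.term k w :=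
    fun k hk => ⟨by_contra fun h => h0 (le_antisymm (le_zero _)
      ((f.term_eq_zero_iff w).2 h ▸ hk)), le_antisymm (eval_le_term k) hk⟩
  exact Or.inr ⟨i, (aux i hi).1, j, (aux j hj).1, hij, (aux i hi).2, (aux j hj).2⟩

theorem zero_mem_hypersurface (w : Fin d → ℝ) : w ∈ (0 : TropPoly d).hypersurface := Or.inl rfl

theorem notMem_hypersurface_iff : w ∉ f.hypersurface ↔
    ∃ i ∈ f.coeff.support, ∀ k ∈ f.coeff.support, k ≠ i → f.term i w < f.term k w := by
  constructor
  · intro h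
    obtain ⟨h0, h⟩ := not_or.1 h
    obtain ⟨i, hi, he⟩ := exists_eval_eq_term (w := w) h0
    refine ⟨i, hi, fun k hk hki => lt_of_le_of_ne (he ▸ eval_le_term k) fun hne => h ?_⟩
    exact ⟨i, hi, k, hk, hki.symm, he, he.trans hne⟩
  · rintro ⟨i, hi, hmin⟩ (h0 | ⟨i₁, h₁, i₂, h₂, hne, e₁, e₂⟩)
    · simp [h0] at hi
    · have aux : ∀ k ∈ f.coeff.support, f.eval w = f.term k w → k = i := fun k hk he => by
        by_contra hki
        exact (hmin k hk hki).not_ge (he ▸ eval_le_term i)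
      exact hne ((aux i₁ h₁ e₁).trans (aux i₂ h₂ e₂).symm)

theorem eval_eq_of_forall_lt {i : Fin d → ℤ}
    (h : ∀ k ∈ f.coeff.support, k ≠ i → f.term i w < f.term k w) : f.eval w = f.term i w := by
  refine le_antisymm (eval_le_term i) (le_eval fun k hk => ?_)
  by_cases hki : k = i
  · rw [hki]
  · exact (h k hk hki).le

theorem ne_zero_of_notMem_hypersurface (h : w ∉ f.hypersurface) : f ≠ 0 :=
  fun h0 => h (Or.inl h0)

theorem eval_ne_zero_of_notMem_hypersurface (h : w ∉ f.hypersurface) : f.eval w ≠ 0 :=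
  fun h0 => ne_zero_of_notMem_hypersurface h (eval_eq_zero_iff.1 h0)

theorem mem_hypersurface_mul_right (h : w ∈ f.hypersurface) (g : TropPoly d) :
    w ∈ (f * g).hypersurface := by
  by_cases hf : f = 0
  · rw [hf, zero_mul]
    exact zero_mem_hypersurface w
  by_cases hg : g = 0
  · rw [hg, mul_zero]
    exact zero_mem_hypersurface w
  obtain ⟨i₁, h₁, i₂, h₂, hne, e₁, e₂⟩ := h.resolve_left hf
  obtain ⟨j, hj, e⟩ := exists_eval_eq_term (w := w) hg
  refine mem_hypersurface_of_lt (i := i₁ + j) (j := i₂ + j) (fun h => hne (add_right_cancel h))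
    ?_ ?_ ?_
  · rw [eval_mul]
    exact mul_ne_zero (fun h => hf (eval_eq_zero_iff.1 h)) (fun h => hg (eval_eq_zero_iff.1 h))
  · rw [eval_mul, e₁, e]
    exact term_mul_le h₁ hj
  · rw [eval_mul, e₂, e]
    exact term_mul_le h₂ hj

theorem mem_hypersurface_mul_left (h : w ∈ g.hypersurface) (f : TropPoly d) :
    w ∈ (f * g).hypersurface := by
  rw [mul_comm]
  exact mem_hypersurface_mul_right h f

theorem mem_hypersurface_add_right (h : w ∈ f.hypersurface) (hle : f.eval w ≤ g.eval w) :
    w ∈ (f + g).hypersurface := by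
  by_cases hf : f = 0
  · have hg : g = 0 := by
      rw [hf, eval_zero] at hle
      exact (eval_eq_zero_iff (w := w)).1 (le_antisymm (le_zero _) hle)
    rw [hf, hg, add_zero]
    exact zero_mem_hypersurface w
  obtain ⟨i₁, h₁, i₂, h₂, hne, e₁, e₂⟩ := h.resolve_left hf
  have hge : f.eval w ≤ (f + g).eval w := le_eval fun k _ => by
    rw [term_add, add_eq_min]
    exact le_min (eval_le_term k) (hle.trans (eval_le_term k))
  refine mem_hypersurface_of_lt hne ?_ ?_ ?_
  · intro h0
    rw [eval_eq_zero_iff] at h0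
    have := (f + g).term_eq_zero_iff w |>.2 (show i₁ ∉ (f + g).coeff.support by simp [h0])
    rw [term_add, add_eq_zero_iff] at this
    exact term_ne_zero h₁ this.1
  · rw [term_add]
    exact le_trans (add_le_left _ _) (e₁ ▸ hge)
  · rw [term_add]
    exact le_trans (add_le_left _ _) (e₂ ▸ hge)

/-- The minimal monomial of `f * g` comes only from the two unique minimizers, and all terms of `p`
are strictly larger. -/
theorem notMem_hypersurface_add {p : TropPoly d} (hf : w ∉ f.hypersurface)
    (hg : w ∉ g.hypersurface) (hlt : (f * g).eval w < p.eval w) :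
    w ∉ (f * g + p).hypersurface := by
  obtain ⟨i, hi, hif⟩ := notMem_hypersurface_iff.1 hf
  obtain ⟨j, hj, hjg⟩ := notMem_hypersurface_iff.1 hg
  have h0 : f.term i w * g.term j w ≠ 0 := mul_ne_zero (term_ne_zero hi) (term_ne_zero hj)
  have hlow : ∀ k, f.term i w * g.term j w < p.term k w := fun k => by
    rw [eval_mul, eval_eq_of_forall_lt hif, eval_eq_of_forall_lt hjg] at hlt
    exact hlt.trans_le (eval_le_term k)
  have hle : (f * g + p).term (i + j) w ≤ f.term i w * g.term j w := by
    rw [term_add]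
    exact le_trans (add_le_left _ _) (term_mul_le hi hj)
  refine notMem_hypersurface_iff.2 ⟨i + j, ?_, fun k _ hk => hle.trans_lt ?_⟩
  · by_contra hc
    rw [((f * g + p).term_eq_zero_iff w).2 hc] at hle
    exact h0 (le_antisymm (le_zero _) hle)
  · rw [term_add]
    refine lt_add ?_ (hlow k)
    rw [term_mul]
    refine lt_sum (Trop.lt_zero_iff.2 h0) fun a ha =>
      lt_sum (Trop.lt_zero_iff.2 h0) fun b hb => ?_
    split_ifs with hab
    · by_cases hai : a = i
      · subst hai
        have hbj : b ≠ j := fun h => hk (by rw [← hab, h])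
        exact Trop.mul_lt_mul_left (term_ne_zero ha) (hjg b hb hbj)
      · by_cases hbj : b = j
        · subst hbj
          exact Trop.mul_lt_mul_right (term_ne_zero hb) (hif a ha hai)
        · exact Trop.mul_lt_mul (hif a ha hai) (hjg b hb hbj)
    · exact Trop.lt_zero_iff.2 h0

/-! ### Euler derivatives -/

section Deriv

variable {L : IntAffine d} {c : ℝ}

theorem mem_support_tropDeriv {i : Fin d → ℤ} :
    i ∈ (tropDeriv f L c).coeff.support ↔ i ∈ f.coeff.support ∧ (L.eval i : ℝ) + c ≠ 0 := by
  classical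
  simp [tropDeriv, and_comm]

theorem term_tropDeriv {i : Fin d → ℤ} (h : (L.eval i : ℝ) + c ≠ 0) :
    (tropDeriv f L c).term i w = f.term i w := by
  classical
  simp [term, tropDeriv, h]

theorem tropDeriv_congr {L' : IntAffine d} {c' : ℝ}
    (h : ∀ i ∈ f.coeff.support, (L.eval i : ℝ) + c = 0 ↔ (L'.eval i : ℝ) + c' = 0) :
    tropDeriv f L c = tropDeriv f L' c' := by
  classical
  refine AddMonoidAlgebra.ext (Finsupp.ext fun i => ?_)
  by_cases hi : i ∈ f.coeff.support
  · have := h i hi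
    by_cases hL : (L.eval i : ℝ) + c = 0
    · simp [tropDeriv, hL, this.1 hL]
    · have hL' : ¬ (L'.eval i : ℝ) + c' = 0 := fun h' => hL (this.2 h')
      simp [tropDeriv, hL, hL']
  · simp [tropDeriv, Finsupp.filter_apply, Finsupp.notMem_support_iff.1 hi]

theorem notMem_hypersurface_tropDeriv_iff : w ∉ (tropDeriv f L c).hypersurface ↔
    HasUniqueMin (fun i : f.coeff.support => (L.eval (i : Fin d → ℤ) : ℝ) + c ≠ 0)
      (fun i => f.term i w) := by
  rw [notMem_hypersurface_iff]
  constructor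
  · rintro ⟨i, hi, hmin⟩
    rw [mem_support_tropDeriv] at hi
    refine ⟨⟨i, hi.1⟩, hi.2, fun k hk hki => ?_⟩
    have := hmin k (mem_support_tropDeriv.2 ⟨k.2, hk⟩) fun h => hki (Subtype.ext h)
    rwa [term_tropDeriv hi.2, term_tropDeriv hk] at this
  · rintro ⟨i, hi, hmin⟩
    refine ⟨i, mem_support_tropDeriv.2 ⟨i.2, hi⟩, fun k hk hki => ?_⟩
    rw [mem_support_tropDeriv] at hk
    rw [term_tropDeriv hi, term_tropDeriv hk.2]
    exact hmin ⟨k, hk.1⟩ hk.2 fun h => hki (congrArg Subtype.val h)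

/-- The minimum over the union of the supports of `t ⊙ ∂f/∂L` and `∂g/∂(L + c)` is not unique if
and only if the values of these polynomials balance. -/
theorem not_hasUniqueMin_sum_iff {t : Trop} (ht : t ≠ 0) :
    (¬ HasUniqueMin
      (Sum.elim (fun i : f.coeff.support => (L.eval (i : Fin d → ℤ) : ℝ) + 0 ≠ 0)
        (fun j : g.coeff.support => (L.eval (j : Fin d → ℤ) : ℝ) + c ≠ 0))
      (Sum.elim (fun i => f.term i w * t) (fun j => g.term j w))) ↔
    (w ∉ (tropDeriv f L 0).hypersurface →
      (tropDeriv g L c).eval w ≤ (tropDeriv f L 0).eval w * t) ∧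
    (w ∉ (tropDeriv g L c).hypersurface →
      (tropDeriv f L 0).eval w * t ≤ (tropDeriv g L c).eval w) := by
  constructor
  · intro h
    constructor
    · intro hf
      obtain ⟨i, hi, hmin⟩ := notMem_hypersurface_iff.1 hf
      have hi' := mem_support_tropDeriv.1 hi
      by_contra hlt
      rw [not_le, eval_eq_of_forall_lt hmin, term_tropDeriv hi'.2] at hlt
      refine h ⟨Sum.inl ⟨i, hi'.1⟩, hi'.2, ?_⟩
      rintro (k | k) hk hki
      · refine Trop.mul_lt_mul_right ht ?_
        have := hmin k (mem_support_tropDeriv.2 ⟨k.2, hk⟩) fun h =>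
          hki (congrArg Sum.inl (Subtype.ext h))
        rwa [term_tropDeriv hi'.2, term_tropDeriv hk] at this
      · have := hlt.trans_le (eval_le_term (k : Fin d → ℤ))
        rwa [term_tropDeriv hk] at this
    · intro hg
      obtain ⟨i, hi, hmin⟩ := notMem_hypersurface_iff.1 hg
      have hi' := mem_support_tropDeriv.1 hi
      by_contra hlt
      rw [not_le, eval_eq_of_forall_lt hmin, term_tropDeriv hi'.2] at hlt
      refine h ⟨Sum.inr ⟨i, hi'.1⟩, hi'.2, ?_⟩
      rintro (k | k) hk hki
      · have := hlt.trans_le (mul_le_mul_left (eval_le_term (k : Fin d → ℤ)) t)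
        rwa [term_tropDeriv hk] at this
      · have := hmin k (mem_support_tropDeriv.2 ⟨k.2, hk⟩) fun h =>
          hki (congrArg Sum.inr (Subtype.ext h))
        rw [term_tropDeriv hi'.2, term_tropDeriv hk] at this
        exact this
  -- A unique minimum over the union is also one within its own derivative; the balance then
  -- produces a term of the other derivative that is no larger.
  · rintro ⟨hf, hg⟩ ⟨i | j, hi, hmin⟩
    · have hstrict : ∀ k ∈ (tropDeriv f L 0).coeff.support, k ≠ i →
          (tropDeriv f L 0).term i w < (tropDeriv f L 0).term k w := fun k hk hki => by
        rw [mem_support_tropDeriv] at hk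
        rw [term_tropDeriv hi, term_tropDeriv hk.2]
        have := hmin (Sum.inl ⟨k, hk.1⟩) hk.2 fun h =>
          hki (congrArg Subtype.val (Sum.inl_injective h))
        exact lt_of_mul_lt_mul_right' (a := t) this
      have hle := hf (notMem_hypersurface_iff.2
        ⟨i, mem_support_tropDeriv.2 ⟨i.2, hi⟩, hstrict⟩)
      rw [eval_eq_of_forall_lt hstrict, term_tropDeriv hi] at hle
      have hne : tropDeriv g L c ≠ 0 := fun h => by
        rw [h, eval_zero] at hle
        exact mul_ne_zero (term_ne_zero i.2) ht (le_antisymm (le_zero _) hle)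
      obtain ⟨k, hk, he⟩ := exists_eval_eq_term (w := w) hne
      rw [mem_support_tropDeriv] at hk
      rw [he, term_tropDeriv hk.2] at hle
      exact (hmin (Sum.inr ⟨k, hk.1⟩) hk.2 (by simp)).not_ge hle
    · have hstrict : ∀ k ∈ (tropDeriv g L c).coeff.support, k ≠ j →
          (tropDeriv g L c).term j w < (tropDeriv g L c).term k w := fun k hk hkj => by
        rw [mem_support_tropDeriv] at hk
        rw [term_tropDeriv hi, term_tropDeriv hk.2]
        exact hmin (Sum.inr ⟨k, hk.1⟩) hk.2 fun h =>
          hkj (congrArg Subtype.val (Sum.inr_injective h))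
      have hle := hg (notMem_hypersurface_iff.2
        ⟨j, mem_support_tropDeriv.2 ⟨j.2, hi⟩, hstrict⟩)
      rw [eval_eq_of_forall_lt hstrict, term_tropDeriv hi] at hle
      have hne : tropDeriv f L 0 ≠ 0 := fun h => by
        rw [h, eval_zero, zero_mul] at hle
        exact term_ne_zero j.2 (le_antisymm (le_zero _) hle)
      obtain ⟨k, hk, he⟩ := exists_eval_eq_term (w := w) hne
      rw [mem_support_tropDeriv] at hk
      rw [he, term_tropDeriv hk.2] at hle
      exact (hmin (Sum.inl ⟨k, hk.1⟩) hk.2 (by simp)).not_ge hle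

end Deriv

end TropPoly

theorem AddValuation.map_units_zpow {K : Type*} [Field K] (v : AddValuation K (WithTop ℝ))
    {b : Kˣ} {r : ℝ} (hb : v (b : K) = (r : WithTop ℝ)) (n : ℤ) :
    v ((b ^ n : Kˣ) : K) = ((n * r : ℝ) : WithTop ℝ) := by
  have hnat : ∀ m : ℕ, v ((b ^ m : Kˣ) : K) = ((m * r : ℝ) : WithTop ℝ) := fun m => by
    rw [Units.val_pow_eq_pow_val, v.map_pow, hb, ← WithTop.coe_nsmul, nsmul_eq_mul]
  obtain ⟨m, rfl | rfl⟩ := n.eq_nat_or_neg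
  · rw [zpow_natCast, hnat, Int.cast_natCast]
  · have h : v ((b ^ m : Kˣ) : K) + v ((b ^ (-(m : ℤ)) : Kˣ) : K) = 0 := by
      rw [← v.map_mul, ← Units.val_mul, zpow_neg, zpow_natCast, mul_inv_cancel, Units.val_one,
        v.map_one]
    rw [hnat] at h
    generalize v ((b ^ (-(m : ℤ)) : Kˣ) : K) = y at h
    cases y with
    | top => simp at h
    | coe y =>
      rw [← WithTop.coe_add] at h
      have h' : (m : ℝ) * r + y = 0 := WithTop.coe_eq_zero.1 h
      rw [WithTop.coe_inj]
      push_cast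
      linarith

/-! ### Laurent polynomials and their families of term values -/

namespace Laurent

variable {d : ℕ} {K : Type*} [Field K]

/-- The value of the monomial of exponent `i` at a point of the torus. -/
def monomialValue (b : Fin d → Kˣ) (i : Fin d → ℤ) : Kˣ := ∏ j, b j ^ i j

theorem coe_monomialValue (b : Fin d → Kˣ) (i : Fin d → ℤ) :
    (monomialValue b i : K) = ∏ j, ((b j ^ i j : Kˣ) : K) := by
  rw [monomialValue, Units.coe_prod]

theorem valuation_monomialValue (v : AddValuation K (WithTop ℝ)) {b : Fin d → Kˣ} {q : Fin d → ℝ}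
    (hb : ∀ j, v (b j : K) = (q j : WithTop ℝ)) (i : Fin d → ℤ) :
    v (monomialValue b i : K) = ((∑ j, (i j : ℝ) * q j : ℝ) : WithTop ℝ) := by
  classical
  rw [coe_monomialValue]
  induction (Finset.univ : Finset (Fin d)) using Finset.induction_on with
  | empty => simp
  | insert j s hj ih =>
    rw [Finset.prod_insert hj, Finset.sum_insert hj, v.map_mul, ih, v.map_units_zpow (hb j),
      WithTop.coe_add]

theorem eval_eq_sum (F : Laurent d K) (b : Fin d → Kˣ) :
    F.eval b = ∑ i ∈ F.coeff.support, F.coeff i * (monomialValue b i : K) := by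
  simp only [Laurent.eval, Finsupp.sum, coe_monomialValue]

theorem eval_add (F G : Laurent d K) (b : Fin d → Kˣ) : (F + G).eval b = F.eval b + G.eval b := by
  classical
  exact Finsupp.sum_add_index' (fun _ => zero_mul _) (fun _ _ _ => add_mul _ _ _)

theorem eval_single (i : Fin d → ℤ) (a : K) (b : Fin d → Kˣ) :
    Laurent.eval (AddMonoidAlgebra.single i a) b = a * (monomialValue b i : K) := by
  rw [Laurent.eval, AddMonoidAlgebra.coeff_single, Finsupp.sum_single_index (zero_mul _),
    coe_monomialValue]

theorem eval_sum {ι : Type*} (s : Finset ι) (F : ι → Laurent d K) (b : Fin d → Kˣ) :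
    Laurent.eval (∑ i ∈ s, F i) b = ∑ i ∈ s, (F i).eval b := by
  classical
  induction s using Finset.induction_on with
  | empty => rfl
  | insert i s hi ih => rw [Finset.sum_insert hi, Finset.sum_insert hi, eval_add, ih]

/-- Multiplying by `b k` turns the partial derivative into the Euler derivative, which weights each
term by its exponent. -/
theorem eval_pderiv (F : Laurent d K) (b : Fin d → Kˣ) (k : Fin d) :
    (b k : K) * (F.pderiv k).eval b =
      ∑ i ∈ F.coeff.support, (i k : K) * (F.coeff i * (monomialValue b i : K)) := by
  classical
  rw [pderiv, Finsupp.sum, eval_sum, Finset.mul_sum]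
  refine Finset.sum_congr rfl fun i _ => ?_
  have h : b k * monomialValue b (i - Pi.single k 1) = monomialValue b i := by
    simp only [monomialValue, Pi.sub_apply, zpow_sub, Finset.prod_mul_distrib, Finset.prod_inv_distrib]
    have h1 : ∏ j, b j ^ (Pi.single k 1 : Fin d → ℤ) j = b k := by
      rw [Finset.prod_eq_single_of_mem k (Finset.mem_univ k)
        fun j _ hj => by rw [Pi.single_eq_of_ne hj, zpow_zero], Pi.single_eq_same, zpow_one]
    rw [h1, mul_left_comm, mul_inv_cancel, mul_one]
  rw [eval_single, ← h, Units.val_mul]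
  ring

theorem support_eq_of_tropicalization_eq {v : AddValuation K (WithTop ℝ)} {F : Laurent d K}
    {f : TropPoly d} (h : F.tropicalization v = f) : F.coeff.support = f.coeff.support := by
  ext i
  rw [← h, Finsupp.mem_support_iff, Finsupp.mem_support_iff, tropicalization,
    AddMonoidAlgebra.coeff_ofCoeff, Finsupp.mapRange_apply, Ne, Ne, ← trop_top,
    trop_injective.eq_iff, v.top_iff]

/-- `x` is the family of the values at a point of valuation `q` of the terms of a polynomial with
tropicalization `f`. -/
def IsTermFamily (v : AddValuation K (WithTop ℝ)) (f : TropPoly d) (q : Fin d → ℝ)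
    (x : f.coeff.support → K) : Prop :=
  ∀ i, trop (v (x i)) = f.term i q

variable {v : AddValuation K (WithTop ℝ)} {f : TropPoly d} {q : Fin d → ℝ} {b : Fin d → Kˣ}

theorem IsTermFamily.ne_zero {x : f.coeff.support → K} (hx : IsTermFamily v f q x)
    (i : f.coeff.support) : x i ≠ 0 := fun h => by
  have := hx i
  rw [h, v.map_zero, trop_top] at this
  exact TropPoly.term_ne_zero i.2 this.symm

theorem exists_termFamily_of_tropicalization (hb : ∀ j, v (b j : K) = (q j : WithTop ℝ))
    {F : Laurent d K} (hF : F.tropicalization v = f) :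
    ∃ x : f.coeff.support → K, IsTermFamily v f q x ∧ F.eval b = ∑ i, x i ∧
      ∀ k, (b k : K) * (F.pderiv k).eval b = ∑ i : f.coeff.support, ((i : Fin d → ℤ) k : K) * x i := by
  refine ⟨fun i => F.coeff i * (monomialValue b i : K), fun i => ?_, ?_, fun k => ?_⟩
  · rw [v.map_mul, trop_add, valuation_monomialValue v hb, TropPoly.term, show trop (v (F.coeff i)) =
      f.coeff i from DFunLike.congr_fun (congrArg AddMonoidAlgebra.coeff hF) (i : Fin d → ℤ)]
  · rw [eval_eq_sum, support_eq_of_tropicalization_eq hF,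
      Finset.sum_coe_sort f.coeff.support fun i => F.coeff i * (monomialValue b i : K)]
  · rw [eval_pderiv, support_eq_of_tropicalization_eq hF, Finset.sum_coe_sort f.coeff.support
      fun i => (i k : K) * (F.coeff i * (monomialValue b i : K))]

/-- Dividing each term by its monomial value recovers the coefficients; lifting a polynomial at a
fixed `b` thus means choosing its term values. -/
theorem exists_tropicalization_of_termFamily (hb : ∀ j, v (b j : K) = (q j : WithTop ℝ))
    {x : f.coeff.support → K} (hx : IsTermFamily v f q x) :
    ∃ F : Laurent d K, F.tropicalization v = f ∧ F.eval b = ∑ i, x i ∧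
      ∀ k, (b k : K) * (F.pderiv k).eval b = ∑ i : f.coeff.support, ((i : Fin d → ℤ) k : K) * x i := by
  classical
  let c : (Fin d → ℤ) → K := fun i =>
    if h : i ∈ f.coeff.support then x ⟨i, h⟩ * ((monomialValue b i)⁻¹ : Kˣ) else 0
  have hc : ∀ i : f.coeff.support, c i * (monomialValue b i : K) = x i := fun i => by
    simp only [c, dif_pos i.2, Units.inv_mul_cancel_right]
  let F : Laurent d K := AddMonoidAlgebra.ofCoeff (Finsupp.onFinset f.coeff.support c
    fun i hi => by_contra fun h => hi (dif_neg h))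
  have hF : F.tropicalization v = f := by
    refine AddMonoidAlgebra.ext (Finsupp.ext fun i => ?_)
    change trop (v (c i)) = f.coeff i
    by_cases hi : i ∈ f.coeff.support
    · have h1 := hx ⟨i, hi⟩
      rw [← hc, v.map_mul, trop_add, valuation_monomialValue v hb, TropPoly.term] at h1
      exact untrop_injective
        ((WithTop.add_right_inj WithTop.coe_ne_top).1 (congrArg untrop h1))
    · simp only [c, dif_neg hi, v.map_zero, trop_top]
      exact (Finsupp.notMem_support_iff.1 hi).symm
  refine ⟨F, hF, ?_, fun k => ?_⟩
  · rw [eval_eq_sum, support_eq_of_tropicalization_eq hF, ← Finset.sum_coe_sort]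
    exact Finset.sum_congr rfl fun i _ => hc i
  · rw [eval_pderiv, support_eq_of_tropicalization_eq hF, ← Finset.sum_coe_sort]
    exact Finset.sum_congr rfl fun i _ => congrArg _ (hc i)

end Laurent

theorem HasUniqueMin.congr {ι Γ Γ' : Type*} [LT Γ] [LT Γ'] {p p' : ι → Prop} {u : ι → Γ}
    {u' : ι → Γ'} (h : HasUniqueMin p u) (hp : ∀ i, p i ↔ p' i)
    (hu : ∀ i k, u i < u k → u' i < u' k) : HasUniqueMin p' u' := by
  obtain ⟨i, hi, hmin⟩ := h
  exact ⟨i, (hp i).1 hi, fun k hk hki => hu i k (hmin k ((hp k).2 hk) hki)⟩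

/-- Integer affine weights correspond to integer combinations of the value and the Euler
derivatives. -/
theorem IntAffine.sum_eval_mul {d : ℕ} {K : Type*} [Field K] {A : Finset (Fin d → ℤ)}
    (L : IntAffine d) (x : A → K) :
    ∑ i : A, (L.eval i : K) * x i =
      ∑ k, (L.lin k : K) * (∑ i : A, ((i : Fin d → ℤ) k : K) * x i) + L.const * ∑ i, x i := by
  simp only [IntAffine.eval, Int.cast_add, Int.cast_sum, Int.cast_mul, add_mul,
    Finset.sum_add_distrib, Finset.sum_mul, Finset.mul_sum]
  rw [Finset.sum_comm]
  simp only [mul_assoc]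

/-! ### Normalisation and degenerate cases of Euler derivatives -/

namespace TropPoly

variable {d : ℕ} {f : TropPoly d} {L : IntAffine d} {q : Fin d → ℝ}

/-- If `L + c` vanishes on the support, `c` is an integer already; otherwise any integer avoiding
the finitely many values `-L(i)` serves. -/
theorem exists_int_tropDeriv_eq (f : TropPoly d) (L : IntAffine d) (c : ℝ) :
    ∃ n : ℤ, tropDeriv f L c = tropDeriv f L n := by
  classical
  by_cases h : ∃ i ∈ f.coeff.support, (L.eval i : ℝ) + c = 0
  · obtain ⟨i, -, hi⟩ := h
    exact ⟨-L.eval i, by push_cast; rw [← eq_neg_of_add_eq_zero_right hi]⟩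
  · push Not at h
    obtain ⟨n, hn⟩ := Infinite.exists_notMem_finset (f.coeff.support.image fun i => -L.eval i)
    refine ⟨n, tropDeriv_congr fun i hi => ⟨fun h0 => absurd h0 (h i hi), fun h0 => ?_⟩⟩
    have h1 : L.eval i + n = 0 := by exact_mod_cast h0
    exact absurd (Finset.mem_image.2 ⟨i, hi, by omega⟩) hn

theorem exists_tropDeriv_zero_eq (f : TropPoly d) (L : IntAffine d) (c : ℝ) :
    ∃ L' : IntAffine d, tropDeriv f L c = tropDeriv f L' 0 := by
  obtain ⟨n, hn⟩ := exists_int_tropDeriv_eq f L c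
  refine ⟨⟨L.lin, L.const + n⟩, hn.trans (tropDeriv_congr fun i _ => ?_)⟩
  simp only [IntAffine.eval]
  push_cast
  rw [add_zero, add_assoc]

theorem tropDeriv_eq_zero_iff {c : ℝ} :
    tropDeriv f L c = 0 ↔ ∀ i ∈ f.coeff.support, (L.eval i : ℝ) + c = 0 := by
  rw [← AddMonoidAlgebra.coeff_eq_zero, ← Finsupp.support_eq_empty, Finset.eq_empty_iff_forall_notMem]
  simp only [mem_support_tropDeriv, not_and, not_not]

/-- For a constant affine function the derivative is `f` itself or `∞`. -/
theorem mem_hypersurface_tropDeriv_of_lin_eq_zero (hq : q ∈ f.hypersurface) (hL : L.lin = 0)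
    (c : ℝ) : q ∈ (tropDeriv f L c).hypersurface := by
  have hev : ∀ i, L.eval i = L.const := fun i => by simp [IntAffine.eval, hL]
  by_contra hn
  obtain ⟨i, hi, hmin⟩ := notMem_hypersurface_tropDeriv_iff.1 hn
  rw [hev] at hi
  refine notMem_hypersurface_iff.2 ⟨i, i.2, fun k hk hki => ?_⟩ hq
  refine hmin ⟨k, hk⟩ (by simpa only [hev] using hi) fun h => hki (congrArg Subtype.val h)

theorem eval_mem_range_term {c : ℝ} (h : (tropDeriv f L c).eval q ≠ 0) :
    ∃ i : f.coeff.support, (tropDeriv f L c).eval q = f.term i q := by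
  obtain ⟨i, hi, he⟩ := exists_eval_eq_term (w := q)
    (fun h0 => h (by rw [h0, eval_zero]) : tropDeriv f L c ≠ 0)
  rw [mem_support_tropDeriv] at hi
  exact ⟨⟨i, hi.1⟩, by rw [he, term_tropDeriv hi.2]⟩

end TropPoly

theorem onLine_of_eval_eq {A : Finset (Fin 2 → ℤ)} {L : IntAffine 2} {c : ℝ}
    (h : ∀ i ∈ A, (L.eval i : ℝ) + c = 0) (hL : L.lin ≠ 0) : OnLine A := by
  rcases A.eq_empty_or_nonempty with rfl | ⟨p, hp⟩
  · simp [OnLine, collinear_empty]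
  rw [OnLine, collinear_iff_of_mem (Set.mem_image_of_mem _ (Finset.mem_coe.2 hp))]
  -- The direction is orthogonal to `L.lin`; the parameter below is the orthogonal projection onto
  -- it.
  refine ⟨![-(L.lin 1 : ℝ), L.lin 0], ?_⟩
  rintro _ ⟨i, hi, rfl⟩
  have h1 := h i hi
  have h2 := h p hp
  simp only [IntAffine.eval, Fin.sum_univ_two] at h1 h2
  push_cast at h1 h2
  have hpos : (0 : ℝ) < (L.lin 0 : ℝ) ^ 2 + (L.lin 1 : ℝ) ^ 2 := by
    by_contra hle
    have h3 : (L.lin 0 : ℝ) = 0 := by nlinarith [sq_nonneg (L.lin 0 : ℝ), sq_nonneg (L.lin 1 : ℝ)]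
    have h4 : (L.lin 1 : ℝ) = 0 := by nlinarith [sq_nonneg (L.lin 0 : ℝ), sq_nonneg (L.lin 1 : ℝ)]
    refine hL (funext fun k => ?_)
    fin_cases k
    · exact_mod_cast h3
    · exact_mod_cast h4
  have h5 : (L.lin 0 : ℝ) * ((i 0 : ℝ) - p 0) + L.lin 1 * ((i 1 : ℝ) - p 1) = 0 := by linarith
  refine ⟨(-(L.lin 1 : ℝ) * ((i 0 : ℝ) - p 0) + L.lin 0 * ((i 1 : ℝ) - p 1)) /
    ((L.lin 0 : ℝ) ^ 2 + (L.lin 1 : ℝ) ^ 2), funext fun k => ?_⟩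
  fin_cases k
  · simp only [Fin.zero_eta, Fin.isValue, vadd_eq_add, Pi.add_apply, Pi.smul_apply,
      Matrix.cons_val_zero, smul_eq_mul]
    field_simp
    linear_combination (L.lin 0 : ℝ) * h5
  · simp only [Fin.mk_one, Fin.isValue, vadd_eq_add, Pi.add_apply, Pi.smul_apply,
      Matrix.cons_val_one, Matrix.cons_val_fin_one, smul_eq_mul]
    field_simp
    linear_combination (L.lin 1 : ℝ) * h5

/-! ### Singular points and zeros via lifting -/

section Singular

open Laurent

variable {d : ℕ} {K : Type*} [Field K] {v : AddValuation K (WithTop ℝ)} {f : TropPoly d}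
  {q : Fin d → ℝ} {b : Fin d → Kˣ}

theorem exists_units_valuation_eq (hq : ∀ j, ∃ a : K, v a = (q j : WithTop ℝ)) :
    ∃ b : Fin d → Kˣ, ∀ j, v (b j : K) = (q j : WithTop ℝ) := by
  choose a ha using hq
  exact ⟨fun j => Units.mk0 (a j) ((v.ne_top_iff).1 (by rw [ha]; exact WithTop.coe_ne_top)),
    fun j => ha j⟩

theorem exists_termFamily (hb : ∀ j, v (b j : K) = (q j : WithTop ℝ))
    (hf : ∀ i ∈ f.coeff.support, ∃ a : K, trop (v a) = f.coeff i) :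
    ∃ x : f.coeff.support → K, IsTermFamily v f q x := by
  choose a ha using hf
  refine ⟨fun i => a i i.2 * (monomialValue b i : K), fun i => ?_⟩
  rw [v.map_mul, trop_add, valuation_monomialValue v hb, ha, TropPoly.term]

theorem Laurent.IsTermFamily.lt_iff {x : f.coeff.support → K} (hx : IsTermFamily v f q x)
    (i k : f.coeff.support) : v (x i) < v (x k) ↔ f.term i q < f.term k q := by
  rw [← hx i, ← hx k]
  exact Iff.rfl

theorem IsSingularPoint.mem_hypersurface
    (hres : CharZero (IsLocalRing.ResidueField (AddValuation.toValuation v).valuationSubring))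
    (h : IsSingularPoint v f q) (L : IntAffine d) (c : ℝ) :
    q ∈ (tropDeriv f L c).hypersurface := by
  obtain ⟨F, b, hF, hb, h0, hd⟩ := h
  obtain ⟨x, hx, hx0, hxd⟩ := exists_termFamily_of_tropicalization hb hF
  obtain ⟨M, hM⟩ := TropPoly.exists_tropDeriv_zero_eq f L c
  rw [hM]
  by_contra hn
  rw [TropPoly.notMem_hypersurface_tropDeriv_iff] at hn
  refine v.not_hasUniqueMin_of_sum_eq_zero hres (n := fun i : f.coeff.support => M.eval i)
    hx.ne_zero ?_ (hn.congr (fun i => ?_) fun i k => (hx.lt_iff i k).2)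
  · rw [IntAffine.sum_eval_mul, ← hx0, h0, mul_zero, add_zero]
    refine Finset.sum_eq_zero fun k _ => ?_
    rw [← hxd, hd, mul_zero, mul_zero]
  · rw [add_zero]
    exact not_congr Int.cast_eq_zero

/-- A singular zero is a rational linear condition on the terms, whose integral consequences are the
forms with weights `L(i)`. -/
theorem exists_singular_lift [CharZero K]
    (hres : CharZero (IsLocalRing.ResidueField (AddValuation.toValuation v).valuationSubring))
    (hb : ∀ j, v (b j : K) = (q j : WithTop ℝ))
    (hf : ∀ i ∈ f.coeff.support, ∃ a : K, trop (v a) = f.coeff i)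
    (h : ∀ L, q ∈ (tropDeriv f L 0).hypersurface) :
    ∃ F : Laurent d K, F.tropicalization v = f ∧ F.eval b = 0 ∧ ∀ k, (F.pderiv k).eval b = 0 := by
  obtain ⟨T, hT⟩ := exists_termFamily hb hf
  obtain ⟨x, hx, hx0⟩ := v.exists_lift hres (ι := f.coeff.support) (m := Fin d ⊕ Unit) (T := T)
    (R := Sum.elim (fun k i => (i : Fin d → ℤ) k) fun _ _ => 1) hT.ne_zero fun n hn => by
      refine TropPoly.notMem_hypersurface_tropDeriv_iff.2 (hn.congr (fun i => ?_) fun i k =>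
        (hT.lt_iff i k).1) (h ⟨fun k => n (Sum.inl k), n (Sum.inr ())⟩)
      rw [add_zero, Int.cast_ne_zero]
      simp [IntAffine.eval]
  have hxT : IsTermFamily v f q x := fun i => by rw [hx, hT]
  obtain ⟨F, hF, hF0, hFd⟩ := exists_tropicalization_of_termFamily hb hxT
  refine ⟨F, hF, ?_, fun k => ?_⟩
  · simpa [hF0] using hx0 (Sum.inr ())
  · have := (hFd k).trans (hx0 (Sum.inl k))
    exact (mul_eq_zero.1 this).resolve_left (b k).ne_zero

/-- The only integral consequences of a vanishing sum of terms are its multiples. The lift exists at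
any given `b` over `q`. -/
theorem exists_zero_lift [CharZero K]
    (hres : CharZero (IsLocalRing.ResidueField (AddValuation.toValuation v).valuationSubring))
    (hb : ∀ j, v (b j : K) = (q j : WithTop ℝ))
    (hf : ∀ i ∈ f.coeff.support, ∃ a : K, trop (v a) = f.coeff i) (h : q ∈ f.hypersurface) :
    ∃ F : Laurent d K, F.tropicalization v = f ∧ F.eval b = 0 := by
  obtain ⟨T, hT⟩ := exists_termFamily hb hf
  obtain ⟨x, hx, hx0⟩ := v.exists_lift hres (ι := f.coeff.support) (m := Unit) (T := T)
    (R := fun _ _ => 1) hT.ne_zero fun n hn => by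
      refine TropPoly.notMem_hypersurface_tropDeriv_iff.2 (hn.congr (fun i => ?_) fun i k =>
        (hT.lt_iff i k).1) (TropPoly.mem_hypersurface_tropDeriv_of_lin_eq_zero (L := ⟨0, n ()⟩)
          h rfl 0)
      rw [add_zero, Int.cast_ne_zero]
      simp [IntAffine.eval]
  have hxT : IsTermFamily v f q x := fun i => by rw [hx, hT]
  obtain ⟨F, hF, hF0, -⟩ := exists_tropicalization_of_termFamily hb hxT
  exact ⟨F, hF, by simpa [hF0] using hx0 ()⟩

end Singular

/-! ### Torus non-transversality as balance of derivatives -/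

/-- The values at `q` of `t ⊙ ∂f/∂L` and `∂g/∂(L + c)` balance: if one of them is attained only
once, then the other one is not larger. -/
def DerivativesBalance {d : ℕ} (f g : TropPoly d) (q : Fin d → ℝ) (L : IntAffine d) (c : ℝ) (t : Trop) :
    Prop :=
  (q ∉ (tropDeriv f L 0).hypersurface →
    (tropDeriv g L c).eval q ≤ (tropDeriv f L 0).eval q * t) ∧
  (q ∉ (tropDeriv g L c).hypersurface →
    (tropDeriv f L 0).eval q * t ≤ (tropDeriv g L c).eval q)

section Torus

open Laurent

variable {K : Type*} [Field K] {v : AddValuation K (WithTop ℝ)} {f g : TropPoly 2}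
  {q : Fin 2 → ℝ} {b : Fin 2 → Kˣ}

theorem trop_valuation_ne_zero {y : K} (hy : y ≠ 0) : trop (v y) ≠ 0 := fun h =>
  (v.ne_top_iff).2 hy (trop_injective h)

theorem IsTorusNonTransversal.exists_balanced
    (hres : CharZero (IsLocalRing.ResidueField (AddValuation.toValuation v).valuationSubring))
    (h : IsTorusNonTransversal v f g q) : ∃ t, ∀ L c, DerivativesBalance f g q L c t := by
  obtain ⟨F, G, b, hF, hG, hb, hF0, hG0, y₁, y₂, hy⟩ := h
  obtain ⟨x, hx, hx0, hxd⟩ := exists_termFamily_of_tropicalization hb hF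
  obtain ⟨z, hz, hz0, hzd⟩ := exists_termFamily_of_tropicalization hb hG
  have hy' : ((y₁ / y₂ : Kˣ) : K) ≠ 0 := (y₁ / y₂).ne_zero
  refine ⟨trop (v (y₁ / y₂ : Kˣ)), fun L c => ?_⟩
  obtain ⟨n, hn⟩ := TropPoly.exists_int_tropDeriv_eq g L c
  rw [DerivativesBalance, hn, ← TropPoly.not_hasUniqueMin_sum_iff (trop_valuation_ne_zero hy')]
  intro hmin
  refine v.not_hasUniqueMin_of_sum_eq_zero hres
    (n := Sum.elim (fun i : f.coeff.support => L.eval i) fun j : g.coeff.support => L.eval j + n)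
    (x := Sum.elim (fun i => x i * (y₁ / y₂ : Kˣ)) z) ?_ ?_ (hmin.congr ?_ ?_)
  · rintro (i | j)
    · exact mul_ne_zero (hx.ne_zero i) hy'
    · exact hz.ne_zero j
  · have hk : ∀ k, (∑ i : f.coeff.support, ((i : Fin 2 → ℤ) k : K) * x i) * (y₁ / y₂ : Kˣ) +
        ∑ j : g.coeff.support, ((j : Fin 2 → ℤ) k : K) * z j = 0 := fun k => by
      rw [← hxd, ← hzd, Units.val_div_eq_div_val]
      have := hy k
      field_simp
      linear_combination (b k : K) * this
    rw [Fintype.sum_sum_type]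
    simp only [Sum.elim_inl, Sum.elim_inr, Int.cast_add, add_mul, Finset.sum_add_distrib,
      ← mul_assoc, ← Finset.sum_mul, ← Finset.mul_sum]
    rw [IntAffine.sum_eval_mul, IntAffine.sum_eval_mul, ← hx0, ← hz0, hF0, hG0]
    simp only [Fin.sum_univ_two]
    linear_combination (L.lin 0 : K) * hk 0 + (L.lin 1 : K) * hk 1
  · rintro (i | j)
    · simp
    · simp only [Sum.elim_inr]
      exact_mod_cast Iff.rfl
  · have hu : ∀ s, trop (v (Sum.elim (fun i => x i * (y₁ / y₂ : Kˣ)) z s)) =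
        Sum.elim (fun i : f.coeff.support => f.term i q * trop (v (y₁ / y₂ : Kˣ)))
          (fun j : g.coeff.support => g.term j q) s := by
      rintro (i | j)
      · rw [Sum.elim_inl, Sum.elim_inl, v.map_mul, trop_add, hx]
      · exact hz j
    intro i k hik
    rw [← hu, ← hu] at hik
    exact hik

theorem isTorusNonTransversal_of_balanced [CharZero K]
    (hres : CharZero (IsLocalRing.ResidueField (AddValuation.toValuation v).valuationSubring))
    (hb : ∀ j, v (b j : K) = (q j : WithTop ℝ))
    (hf : ∀ i ∈ f.coeff.support, ∃ a : K, trop (v a) = f.coeff i)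
    (hg : ∀ i ∈ g.coeff.support, ∃ a : K, trop (v a) = g.coeff i)
    (y : Kˣ) (h : ∀ L c, DerivativesBalance f g q L c (trop (v (y : K)))) :
    IsTorusNonTransversal v f g q := by
  obtain ⟨T, hT⟩ := exists_termFamily hb hf
  obtain ⟨U, hU⟩ := exists_termFamily hb hg
  have hu : ∀ s, trop (v (Sum.elim (fun i => T i * (y : K)) U s)) =
      Sum.elim (fun i : f.coeff.support => f.term i q * trop (v (y : K)))
        (fun j : g.coeff.support => g.term j q) s := by
    rintro (i | j)
    · rw [Sum.elim_inl, Sum.elim_inl, v.map_mul, trop_add, hT]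
    · exact hU j
  obtain ⟨x, hx, hx0⟩ := v.exists_lift hres (m := Fin 2 ⊕ Bool)
    (ι := f.coeff.support ⊕ g.coeff.support)
    (T := Sum.elim (fun i => T i * (y : K)) U)
    -- The rows are the two derivative equations, then `F(b) = 0` (for `true`) and `G(b) = 0` (for
    -- `false`). Separate constants on the two supports are what `L` and `L + c` encode.
    (R := Sum.elim (fun k => Sum.elim (fun i => (i : Fin 2 → ℤ) k) fun j => (j : Fin 2 → ℤ) k)
      fun s => Sum.elim (fun _ => if s then 1 else 0) fun _ => if s then 0 else 1)
    (by
      rintro (i | j)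
      · exact mul_ne_zero (hT.ne_zero i) y.ne_zero
      · exact hU.ne_zero j)
    fun n hn => by
      refine (TropPoly.not_hasUniqueMin_sum_iff (trop_valuation_ne_zero y.ne_zero)).2
        (h ⟨fun k => n (Sum.inl k), n (Sum.inr true)⟩
          ((n (Sum.inr false) - n (Sum.inr true) : ℤ) : ℝ)) (hn.congr ?_ fun i k hik => ?_)
      · rintro (i | j)
        · simp only [Sum.elim_inl]
          rw [add_zero, Int.cast_ne_zero]
          simp [IntAffine.eval]
        · simp only [Sum.elim_inr]
          rw [← Int.cast_add, Int.cast_ne_zero]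
          simp [IntAffine.eval]
      · rw [← hu, ← hu]
        exact hik
  simp only [Fintype.sum_sum_type] at hx0
  have hxT : IsTermFamily v f q fun i => x (Sum.inl i) * ((y⁻¹ : Kˣ) : K) := fun i => by
    have := hx (Sum.inl i)
    rw [Sum.elim_inl] at this
    rw [v.map_mul, this, ← v.map_mul, mul_assoc, y.mul_inv, mul_one, hT]
  have hzT : IsTermFamily v g q fun j => x (Sum.inr j) := fun j => by
    rw [hx, Sum.elim_inr, hU]
  obtain ⟨F, hF, hF0, hFd⟩ := exists_tropicalization_of_termFamily hb hxT
  obtain ⟨G, hG, hG0, hGd⟩ := exists_tropicalization_of_termFamily hb hzT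
  refine ⟨F, G, b, hF, hG, hb, ?_, ?_, y, 1, fun k => ?_⟩
  · rw [hF0, ← Finset.sum_mul]
    have : ∑ i, x (Sum.inl i) = 0 := by simpa using hx0 (Sum.inr true)
    rw [this, zero_mul]
  · rw [hG0]
    have := hx0 (Sum.inr false)
    simpa using this
  · refine (mul_eq_zero.1 (?_ : (b k : K) * _ = 0)).resolve_left (b k).ne_zero
    have := hx0 (Sum.inl k)
    simp only [Sum.elim_inl, Sum.elim_inr] at this
    rw [mul_add, ← mul_assoc, ← mul_assoc, hFd, hGd, Units.val_one, mul_one, ← this]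
    simp only [← mul_assoc, ← Finset.sum_mul]
    rw [mul_assoc, y.inv_mul, mul_one]

end Torus

/-! ### Compatibility of bounds on the multiplier -/

/-- One-dimensional Helly property: the bounds `ψ x ≤ φ x * t` for `P x` and `φ x * t ≤ ψ x` for
`Q x` have a common solution `t` if they are pairwise compatible. -/
theorem exists_common_multiplier {X : Type*} {φ ψ : X → Trop} {P Q : X → Prop} {C : Set Trop}
    (hC : C.Finite) (hcand : ∀ x, φ x ≠ 0 → ψ x ≠ 0 → ∃ t ∈ C, φ x * t = ψ x)
    (hP : ∀ x, P x → φ x ≠ 0 ∧ ψ x ≠ 0) (hQ : ∀ x, Q x → φ x ≠ 0 ∧ ψ x ≠ 0)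
    (hPQ : ∀ x y, P x → Q y → φ y * ψ x ≤ φ x * ψ y) :
    ∃ t, (t = 1 ∨ t ∈ C) ∧ ∀ x, (P x → ψ x ≤ φ x * t) ∧ (Q x → φ x * t ≤ ψ x) := by
  by_cases hexP : ∃ x, P x
  · obtain ⟨x₀, hx₀⟩ := hexP
    obtain ⟨t₀, ht₀, e₀⟩ := hcand x₀ (hP x₀ hx₀).1 (hP x₀ hx₀).2
    -- The largest lower bound is attained, because all bounds lie in the finite set `C`.
    obtain ⟨t, ⟨ht, x, hx, e⟩, hmax⟩ := Set.exists_max_image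
      {t | t ∈ C ∧ ∃ x, P x ∧ φ x * t = ψ x} id (hC.subset fun t ht => ht.1)
      ⟨t₀, ht₀, x₀, hx₀, e₀⟩
    refine ⟨t, Or.inr ht, fun y => ⟨fun hy => ?_, fun hy => ?_⟩⟩
    · obtain ⟨s, hs, es⟩ := hcand y (hP y hy).1 (hP y hy).2
      rw [← es]
      exact mul_le_mul_right (hmax s ⟨hs, y, hy, es⟩) _
    · have := hPQ x y hx hy
      rw [← e, mul_left_comm] at this
      by_contra hlt
      exact (Trop.mul_lt_mul_left (hP x hx).1 (not_le.1 hlt)).not_ge this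
  by_cases hexQ : ∃ x, Q x
  · obtain ⟨x₀, hx₀⟩ := hexQ
    obtain ⟨t₀, ht₀, e₀⟩ := hcand x₀ (hQ x₀ hx₀).1 (hQ x₀ hx₀).2
    obtain ⟨t, ⟨ht, -⟩, hmin⟩ := Set.exists_min_image
      {t | t ∈ C ∧ ∃ x, Q x ∧ φ x * t = ψ x} id (hC.subset fun t ht => ht.1)
      ⟨t₀, ht₀, x₀, hx₀, e₀⟩
    refine ⟨t, Or.inr ht, fun y => ⟨fun hy => absurd ⟨y, hy⟩ hexP, fun hy => ?_⟩⟩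
    obtain ⟨s, hs, es⟩ := hcand y (hQ y hy).1 (hQ y hy).2
    rw [← es]
    exact mul_le_mul_right (hmin s ⟨hs, y, hy, es⟩) _
  · exact ⟨1, Or.inl rfl, fun y =>
      ⟨fun hy => absurd ⟨y, hy⟩ hexP, fun hy => absurd ⟨y, hy⟩ hexQ⟩⟩

/-! ### Reformulation and finiteness of the two conditions -/

namespace FourTuple

/-- Exchange the roles of the two integer affine functions. -/
def swap (τ : FourTuple) : FourTuple := ⟨τ.L₂, τ.L₁, τ.c₂, τ.c₁⟩

/-- If the minima of `∂f/∂L₁` and `∂g/∂(L₂ + c₂)` at `q` are attained only once, then the value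
of the second product is at most the one of the first. -/
def ProductBound (τ : FourTuple) (f g : TropPoly 2) (q : Fin 2 → ℝ) : Prop :=
  q ∉ (tropDeriv f τ.L₁ 0).hypersurface → q ∉ (tropDeriv g τ.L₂ τ.c₂).hypersurface →
    (τ.prod₂ f g).eval q ≤ (τ.prod₁ f g).eval q

/-- The two conditions for one tuple. -/
def ConditionsAt (τ : FourTuple) (f g : TropPoly 2) (q : Fin 2 → ℝ) : Prop :=
  (τ ∈ setA f g q → q ∈ (τ.prod₁ f g + τ.prod₂ f g).hypersurface) ∧
  (τ ∈ setB f g q → (τ.prod₁ f g).eval q = (τ.prod₂ f g).eval q)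

variable {τ : FourTuple} {f g : TropPoly 2} {q : Fin 2 → ℝ}

theorem prod₁_swap : τ.swap.prod₁ f g = τ.prod₂ f g := rfl

theorem prod₂_swap : τ.swap.prod₂ f g = τ.prod₁ f g := rfl

theorem mem_setB_iff : τ ∈ setB f g q ↔ τ ∉ setA f g q := by
  simp only [setA, setB, Set.mem_ofPred_eq, not_or]

theorem mem_setA_swap : τ.swap ∈ setA f g q ↔ τ ∈ setA f g q := by
  simp only [setA, swap, Set.mem_ofPred_eq]
  tauto

theorem ConditionsAt.swap (h : τ.ConditionsAt f g q) : τ.swap.ConditionsAt f g q := by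
  refine ⟨fun hA => ?_, fun hB => ?_⟩
  · rw [add_comm]
    exact h.1 (mem_setA_swap.1 hA)
  · refine (h.2 (mem_setB_iff.2 fun hA => ?_)).symm
    exact mem_setB_iff.1 hB (mem_setA_swap.2 hA)

/-- If the first product has a unique minimal monomial and were strictly smaller, it would give the
sum a unique minimum, against condition 1. -/
theorem ConditionsAt.productBound (h : τ.ConditionsAt f g q) : τ.ProductBound f g q := by
  intro h1 h2
  by_cases hA : τ ∈ setA f g q
  · by_contra hlt
    exact TropPoly.notMem_hypersurface_add h1 h2 (not_le.1 hlt) (h.1 hA)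
  · exact (h.2 (mem_setB_iff.2 hA)).ge

/-- If a factor of the smaller product is degenerate at `q`, its double minimum survives in the sum.
Otherwise the bound makes the two values equal, and the degenerate factor belongs to the other
product. -/
theorem mem_hypersurface_of_productBound (h : τ.ProductBound f g q) (hA : τ ∈ setA f g q)
    (hle : (τ.prod₁ f g).eval q ≤ (τ.prod₂ f g).eval q) :
    q ∈ (τ.prod₁ f g + τ.prod₂ f g).hypersurface := by
  by_cases h1 : q ∈ (tropDeriv f τ.L₁ 0).hypersurface
  · exact TropPoly.mem_hypersurface_add_right (TropPoly.mem_hypersurface_mul_right h1 _) hle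
  by_cases h2 : q ∈ (tropDeriv g τ.L₂ τ.c₂).hypersurface
  · exact TropPoly.mem_hypersurface_add_right (TropPoly.mem_hypersurface_mul_left h2 _) hle
  rw [add_comm]
  refine TropPoly.mem_hypersurface_add_right ?_ (h h1 h2)
  rcases hA with h3 | h3 | h3 | h3
  · exact absurd h3 h1
  · exact TropPoly.mem_hypersurface_mul_right h3 _
  · exact TropPoly.mem_hypersurface_mul_left h3 _
  · exact absurd h3 h2

theorem conditionsAt_of_productBound (h : τ.ProductBound f g q)
    (hs : τ.swap.ProductBound f g q) : τ.ConditionsAt f g q := by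
  refine ⟨fun hA => ?_, fun hB => le_antisymm (hs hB.2.1 hB.2.2.1) (h hB.1 hB.2.2.2)⟩
  rcases le_total ((τ.prod₁ f g).eval q) ((τ.prod₂ f g).eval q) with hle | hle
  · exact mem_hypersurface_of_productBound h hA hle
  · rw [add_comm]
    have := mem_hypersurface_of_productBound hs (mem_setA_swap.2 hA)
    rw [prod₁_swap, prod₂_swap] at this
    exact this hle

theorem conditions_iff {S : Set FourTuple} :
    Conditions S f g q ↔ ∀ τ ∈ S, τ.ConditionsAt f g q :=
  ⟨fun h τ hτ => ⟨fun hA => h.1 τ ⟨hτ, hA⟩, fun hB => h.2 τ ⟨hτ, hB⟩⟩,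
    fun h => ⟨fun τ hτ => (h τ hτ.1).1 hτ.2, fun τ hτ => (h τ hτ.1).2 hτ.2⟩⟩

theorem conditions_univ_iff :
    Conditions Set.univ f g q ↔ ∀ τ : FourTuple, τ.ProductBound f g q :=
  conditions_iff.trans ⟨fun h τ => (h τ trivial).productBound,
    fun h τ _ => conditionsAt_of_productBound (h τ) (h τ.swap)⟩

theorem exists_finite_conditions (A₁ A₂ : Finset (Fin 2 → ℤ)) :
    ∃ S : Set FourTuple, S.Finite ∧ ∀ (f g : TropPoly 2) (q : Fin 2 → ℝ),
      f.coeff.support = A₁ → g.coeff.support = A₂ →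
      (Conditions Set.univ f g q ↔ Conditions S f g q) := by
  classical
  let κ (A : Finset (Fin 2 → ℤ)) (L : IntAffine 2) (c : ℝ) : Finset (Fin 2 → ℤ) :=
    A.filter fun i => (L.eval i : ℝ) + c = 0
  let pattern : FourTuple → Finset (Fin 2 → ℤ) × Finset (Fin 2 → ℤ) × Finset (Fin 2 → ℤ) ×
    Finset (Fin 2 → ℤ) := fun τ =>
      (κ A₁ τ.L₁ 0, κ A₁ τ.L₂ 0, κ A₂ τ.L₁ τ.c₁, κ A₂ τ.L₂ τ.c₂)
  have hfin : (pattern '' Set.univ).Finite := by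
    refine (A₁.powerset ×ˢ A₁.powerset ×ˢ A₂.powerset ×ˢ A₂.powerset).finite_toSet.subset ?_
    rintro _ ⟨τ, -, rfl⟩
    simp only [pattern, κ, Finset.mem_coe, Finset.mem_product, Finset.mem_powerset,
      Finset.filter_subset, and_self]
  -- One representative is chosen for each realised pattern of zero sets.
  obtain ⟨S, -, hS⟩ := Set.exists_subset_bijOn Set.univ pattern
  refine ⟨S, hS.finite_iff_finite.2 hfin, fun f g q hf hg => ?_⟩
  rw [conditions_iff, conditions_iff]
  refine ⟨fun h τ _ => h τ trivial, fun h τ _ => ?_⟩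
  obtain ⟨σ, hσ, hστ⟩ := hS.surjOn (Set.mem_image_of_mem pattern (Set.mem_univ τ))
  have hderiv : ∀ (p : TropPoly 2) (L M : IntAffine 2) (c e : ℝ),
      κ p.coeff.support L c = κ p.coeff.support M e → tropDeriv p L c = tropDeriv p M e :=
    fun p L M c e he => TropPoly.tropDeriv_congr fun i hi => by
      simpa [κ, hi] using Finset.ext_iff.1 he i
  subst hf hg
  simp only [pattern, Prod.mk.injEq] at hστ
  obtain ⟨h1, h2, h3, h4⟩ := hστ
  have := h σ hσ
  simpa only [ConditionsAt, setA, setB, Set.mem_ofPred_eq, prod₁, prod₂, hderiv _ _ _ _ _ h1,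
    hderiv _ _ _ _ _ h2, hderiv _ _ _ _ _ h3, hderiv _ _ _ _ _ h4] using this

end FourTuple

/-! ### Equivalence of the conditions with non-transversality -/

section Main

open FourTuple

variable {K : Type*} [Field K] {v : AddValuation K (WithTop ℝ)} {f g : TropPoly 2}
  {q : Fin 2 → ℝ} {b : Fin 2 → Kˣ}

theorem IsTorusNonTransversal.isNonTransversal (h : IsTorusNonTransversal v f g q) :
    IsNonTransversal v f g q := by
  obtain ⟨F, G, b, hF, hG, hb, hF0, hG0, y₁, y₂, hy⟩ := h
  refine ⟨F, G, b, hF, hG, hb, hF0, hG0, Matrix.exists_mulVec_eq_zero_iff.1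
    ⟨![(y₁ : K), y₂], fun h => y₁.ne_zero (congrFun h 0), funext fun k => ?_⟩⟩
  fin_cases k
  · simpa [Matrix.mulVec, dotProduct] using hy 0
  · simpa [Matrix.mulVec, dotProduct] using hy 1

/-- A zero coordinate of the kernel vector forces the gradient of the other polynomial to vanish. -/
theorem IsNonTransversal.singular_or_torus (h : IsNonTransversal v f g q) :
    IsSingularPoint v f q ∨ IsSingularPoint v g q ∨ IsTorusNonTransversal v f g q := by
  obtain ⟨F, G, b, hF, hG, hb, hF0, hG0, hdet⟩ := h
  obtain ⟨y, hy, hmul⟩ := Matrix.exists_mulVec_eq_zero_iff.2 hdet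
  have hk : ∀ k, (F.pderiv k).eval b * y 0 + (G.pderiv k).eval b * y 1 = 0 := fun k => by
    have := congrFun hmul k
    fin_cases k
    · simpa [Matrix.mulVec, dotProduct] using this
    · simpa [Matrix.mulVec, dotProduct] using this
  by_cases h0 : y 0 = 0
  · have h1 : y 1 ≠ 0 := fun h1 => hy (funext fun k => by fin_cases k <;> assumption)
    refine Or.inr (Or.inl ⟨G, b, hG, hb, hG0, fun k => ?_⟩)
    simpa [h0, h1] using hk k
  by_cases h1 : y 1 = 0
  · refine Or.inl ⟨F, b, hF, hb, hF0, fun k => ?_⟩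
    simpa [h0, h1] using hk k
  · exact Or.inr (Or.inr ⟨F, G, b, hF, hG, hb, hF0, hG0, Units.mk0 _ h0, Units.mk0 _ h1, hk⟩)

/-- At a singular point all derivative curves of that polynomial contain `q`, so the bound is
vacuous. In the torus case a lower and an upper bound on `t` combine to it. -/
theorem IsNonTransversal.productBound
    (hres : CharZero (IsLocalRing.ResidueField (AddValuation.toValuation v).valuationSubring))
    (h : IsNonTransversal v f g q) (τ : FourTuple) : τ.ProductBound f g q := by
  intro h1 h2
  rcases h.singular_or_torus with h | h | h
  · exact absurd (h.mem_hypersurface hres _ _) h1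
  · exact absurd (h.mem_hypersurface hres _ _) h2
  · obtain ⟨t, ht⟩ := h.exists_balanced hres
    rw [prod₁, prod₂, TropPoly.eval_mul, TropPoly.eval_mul]
    calc _ ≤ (tropDeriv f τ.L₂ 0).eval q * ((tropDeriv f τ.L₁ 0).eval q * t) :=
          mul_le_mul_right ((ht τ.L₁ τ.c₁).1 h1) _
      _ = (tropDeriv f τ.L₁ 0).eval q * ((tropDeriv f τ.L₂ 0).eval q * t) :=
          mul_left_comm _ _ _
      _ ≤ _ := mul_le_mul_right ((ht τ.L₂ τ.c₂).2 h2) _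

theorem isTorusNonTransversal_of_productBound [CharZero K]
    (hres : CharZero (IsLocalRing.ResidueField (AddValuation.toValuation v).valuationSubring))
    (hb : ∀ j, v (b j : K) = (q j : WithTop ℝ))
    (hf : ∀ i ∈ f.coeff.support, ∃ a : K, trop (v a) = f.coeff i)
    (hg : ∀ i ∈ g.coeff.support, ∃ a : K, trop (v a) = g.coeff i)
    (hqf : q ∈ f.hypersurface) (hqg : q ∈ g.hypersurface)
    (hfs : OnLine f.coeff.support → ∃ L, q ∉ (tropDeriv f L 0).hypersurface)
    (hgs : OnLine g.coeff.support → ∃ L, q ∉ (tropDeriv g L 0).hypersurface)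
    (h : ∀ τ : FourTuple, τ.ProductBound f g q) : IsTorusNonTransversal v f g q := by
  obtain ⟨T, hT⟩ := exists_termFamily hb hf
  obtain ⟨U, hU⟩ := exists_termFamily hb hg
  have hbound : ∀ x y : IntAffine 2 × ℝ, q ∉ (tropDeriv f x.1 0).hypersurface →
      q ∉ (tropDeriv g y.1 y.2).hypersurface →
      (tropDeriv f y.1 0).eval q * (tropDeriv g x.1 x.2).eval q ≤
        (tropDeriv f x.1 0).eval q * (tropDeriv g y.1 y.2).eval q := fun x y hx hy => by
    have := h ⟨x.1, y.1, x.2, y.2⟩ hx hy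
    rwa [prod₁, prod₂, TropPoly.eval_mul, TropPoly.eval_mul] at this
  -- A finite right-hand side in the product bound forces both factors on the left to be finite.
  have hfinite : ∀ x y : IntAffine 2 × ℝ, q ∉ (tropDeriv f x.1 0).hypersurface →
      q ∉ (tropDeriv g y.1 y.2).hypersurface →
      (tropDeriv f y.1 0).eval q ≠ 0 ∧ (tropDeriv g x.1 x.2).eval q ≠ 0 := fun x y hx hy => by
    rw [← mul_ne_zero_iff, ← Trop.lt_zero_iff]
    refine (hbound x y hx hy).trans_lt (Trop.lt_zero_iff.2 (mul_ne_zero ?_ ?_))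
    · exact TropPoly.eval_ne_zero_of_notMem_hypersurface hx
    · exact TropPoly.eval_ne_zero_of_notMem_hypersurface hy
  obtain ⟨t, htC, ht⟩ := exists_common_multiplier (X := IntAffine 2 × ℝ)
    (φ := fun x => (tropDeriv f x.1 0).eval q) (ψ := fun x => (tropDeriv g x.1 x.2).eval q)
    (P := fun x => q ∉ (tropDeriv f x.1 0).hypersurface)
    (Q := fun x => q ∉ (tropDeriv g x.1 x.2).hypersurface)
    -- Derivative values are term values, so the candidates are quotients of terms; this keeps `t`
    -- in the value group.
    (C := Set.range fun p : f.coeff.support × g.coeff.support => trop (v (U p.2 / T p.1)))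
    (Set.finite_range _)
    (fun x hφ hψ => by
      obtain ⟨i, hi⟩ := TropPoly.eval_mem_range_term hφ
      obtain ⟨j, hj⟩ := TropPoly.eval_mem_range_term hψ
      refine ⟨_, ⟨(i, j), rfl⟩, ?_⟩
      simp only [hi, hj]
      rw [← hT, ← hU, ← trop_add, ← v.map_mul, mul_div_cancel₀ _ (hT.ne_zero i)])
    (fun x hx => by
      refine ⟨TropPoly.eval_ne_zero_of_notMem_hypersurface hx, fun h0 => ?_⟩
      -- If `∂g/∂(L + c)` is `∞`, either the support of `g` is on a line, where non-singularity
      -- supplies a partner for the product bound, or `L` is constant, which `hx` excludes.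
      by_cases hline : OnLine g.coeff.support
      · obtain ⟨M, hM⟩ := hgs hline
        exact (hfinite x (M, 0) hx hM).2 h0
      · refine hx (TropPoly.mem_hypersurface_tropDeriv_of_lin_eq_zero hqf ?_ 0)
        by_contra hL
        exact hline (onLine_of_eval_eq
          (TropPoly.tropDeriv_eq_zero_iff.1 (TropPoly.eval_eq_zero_iff.1 h0)) hL))
    (fun x hx => by
      refine ⟨fun h0 => ?_, TropPoly.eval_ne_zero_of_notMem_hypersurface hx⟩
      by_cases hline : OnLine f.coeff.support
      · obtain ⟨M, hM⟩ := hfs hline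
        exact (hfinite (M, 0) x hM hx).1 h0
      · refine hx (TropPoly.mem_hypersurface_tropDeriv_of_lin_eq_zero hqg ?_ x.2)
        by_contra hL
        exact hline (onLine_of_eval_eq
          (TropPoly.tropDeriv_eq_zero_iff.1 (TropPoly.eval_eq_zero_iff.1 h0)) hL))
    hbound
  obtain ⟨y, rfl⟩ : ∃ y : Kˣ, trop (v (y : K)) = t := by
    rcases htC with rfl | ⟨p, rfl⟩
    · exact ⟨1, by rw [Units.val_one, v.map_one, trop_zero]⟩
    · exact ⟨Units.mk0 _ (div_ne_zero (hU.ne_zero p.2) (hT.ne_zero p.1)), rfl⟩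
  exact isTorusNonTransversal_of_balanced hres hb hf hg y fun L c => ht (L, c)

theorem exists_notMem_hypersurface_of_not_isSingularPoint [CharZero K] {d : ℕ} {f : TropPoly d}
    {q : Fin d → ℝ} {b : Fin d → Kˣ}
    (hres : CharZero (IsLocalRing.ResidueField (AddValuation.toValuation v).valuationSubring))
    (hb : ∀ j, v (b j : K) = (q j : WithTop ℝ))
    (hf : ∀ i ∈ f.coeff.support, ∃ a : K, trop (v a) = f.coeff i)
    (h : ¬ IsSingularPoint v f q) : ∃ L, q ∉ (tropDeriv f L 0).hypersurface := by
  by_contra! hall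
  obtain ⟨F, hF, hF0, hFd⟩ := exists_singular_lift hres hb hf hall
  exact h ⟨F, b, hF, hb, hF0, hFd⟩

theorem isNonTransversal_of_productBound [CharZero K]
    (hres : CharZero (IsLocalRing.ResidueField (AddValuation.toValuation v).valuationSubring))
    (hb : ∀ j, v (b j : K) = (q j : WithTop ℝ))
    (hf : ∀ i ∈ f.coeff.support, ∃ a : K, trop (v a) = f.coeff i)
    (hg : ∀ i ∈ g.coeff.support, ∃ a : K, trop (v a) = g.coeff i)
    (hqf : q ∈ f.hypersurface) (hqg : q ∈ g.hypersurface)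
    (h : ∀ τ : FourTuple, τ.ProductBound f g q) : IsNonTransversal v f g q := by
  by_cases hfs : IsSingularPoint v f q
  · obtain ⟨F, b', hF, hb', hF0, hFd⟩ := hfs
    -- `G` is lifted at the singular zero of `F`, where one column of the Jacobian matrix vanishes.
    obtain ⟨G, hG, hG0⟩ := exists_zero_lift hres hb' hg hqg
    exact ⟨F, G, b', hF, hG, hb', hF0, hG0, by simp [Matrix.det_fin_two, hFd]⟩
  by_cases hgs : IsSingularPoint v g q
  · obtain ⟨G, b', hG, hb', hG0, hGd⟩ := hgs
    obtain ⟨F, hF, hF0⟩ := exists_zero_lift hres hb' hf hqf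
    exact ⟨F, G, b', hF, hG, hb', hF0, hG0, by simp [Matrix.det_fin_two, hGd]⟩
  · exact (isTorusNonTransversal_of_productBound hres hb hf hg hqf hqg
      (fun _ => exists_notMem_hypersurface_of_not_isSingularPoint hres hb hf hfs)
      (fun _ => exists_notMem_hypersurface_of_not_isSingularPoint hres hb hg hgs)
      h).isNonTransversal

end Main

end

theorem mainTheorem11 {K : Type*} [Field K] [IsAlgClosed K] [CharZero K]
    (v : AddValuation K (WithTop ℝ))
    (hres : CharZero (IsLocalRing.ResidueField
      (AddValuation.toValuation v).valuationSubring))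
    (A₁ A₂ : Finset (Fin 2 → ℤ)) :
    ∃ S : Set FourTuple, S.Finite ∧
      ∀ (f g : TropPoly 2) (q : Fin 2 → ℝ),
        f.coeff.support = A₁ → g.coeff.support = A₂ →
        (∀ i ∈ A₁, ∃ a : K, trop (v a) = f.coeff i) →
        (∀ i ∈ A₂, ∃ a : K, trop (v a) = g.coeff i) →
        (∀ j, ∃ a : K, v a = (q j : WithTop ℝ)) →
        A₁.Nonempty → A₂.Nonempty →
        q ∈ f.hypersurface → q ∈ g.hypersurface →
          (IsNonTransversal v f g q ↔ FourTuple.Conditions Set.univ f g q) ∧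
          (IsNonTransversal v f g q ↔ FourTuple.Conditions S f g q) ∧
          ((OnLine A₁ → ¬ IsSingularPoint v f q) → (OnLine A₂ → ¬ IsSingularPoint v g q) →
            (IsTorusNonTransversal v f g q ↔ FourTuple.Conditions Set.univ f g q) ∧
            (IsTorusNonTransversal v f g q ↔ FourTuple.Conditions S f g q))
      := by
  obtain ⟨S, hS, hSc⟩ := FourTuple.exists_finite_conditions A₁ A₂
  refine ⟨S, hS, fun f g q hf hg hfv hgv hq _ _ hqf hqg => ?_⟩
  obtain ⟨b, hb⟩ := exists_units_valuation_eq hq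
  rw [← hSc f g q hf hg, FourTuple.conditions_univ_iff]
  subst hf hg
  have key : IsNonTransversal v f g q ↔ ∀ τ : FourTuple, τ.ProductBound f g q :=
    ⟨fun h => h.productBound hres, isNonTransversal_of_productBound hres hb hfv hgv hqf hqg⟩
  refine ⟨key, key, fun hfs hgs => ?_⟩
  have keyTorus : IsTorusNonTransversal v f g q ↔ ∀ τ : FourTuple, τ.ProductBound f g q :=
    ⟨fun h => h.isNonTransversal.productBound hres,
      isTorusNonTransversal_of_productBound hres hb hfv hgv hqf hqg
        (fun h => exists_notMem_hypersurface_of_not_isSingularPoint hres hb hfv (hfs h))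
        (fun h => exists_notMem_hypersurface_of_not_isSingularPoint hres hb hgv (hgs h))⟩
  exact ⟨keyTorus, keyTorus⟩
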